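/- Let $d\in\mathbb{N}_0$, let $D,G\in\mathbb{R}^{d\times d}$, and let $\gamma:[0,\infty)\to\mathbb{R}^{d\times d}$ be in $L^1_{\mathrm{loc}}([0,\infty))$, i.e., integrable on every bounded interval $[0,T]$. On a probability space let $V_0$ be a centered Gaussian random variable with values in $\mathbb{R}^d$, let $W$ be a standard $d$-dimensional Brownian motion (with continuous paths and $W(0)=0$ almost surely), and let $F_0=(F_0(t))_{t\ge0}$ be a jointly measurable $d$-dimensional Gaussian process that is mean-square bounded, $\sup_{t\ge 0}\mathbb{E}\|F_0(t)\|^2<\infty$, and mean-square continuous, $\mathbb{E}\|F_0(s)-F_0(t)\|^2\to0$ as $s\to t$. No assumption is made on the joint law of $V_0$, $F_0$ and $W$. Put $F=F_0+G\dot W$, so that $\int_0^tF(\tau)\,d\tau:=\int_0^tF_0(\tau)\,d\tau+G\,W(t)$. (a) There is exactly one function $r:[0,\infty)\to\mathbb{R}^{d\times d}$ (the differential resolvent) with $$r'(t)=-Dr(t)-\int_0^t\gamma(t-s)r(s)\,ds\quad\text{for all } t\ge0,\qquad r(0)=I.$$ (b) The generalized Langevin equation $$\dot V(t)=-DV(t)-\int_0^t\gamma(t-s)V(s)\,ds+F(t),\qquad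 V(0)=V_0,$$ has a strong solution, i.e., there is an $\mathbb{R}^d$-valued stochastic process $V=(V(t))_{t\ge0}$ such that almost surely the paths of $F_0$ and of $V$ are locally integrable on $[0,\infty)$ and $$V(t)=V_0-D\int_0^tV(s)\,ds-\int_0^t\int_0^\tau\gamma(\tau-s)V(s)\,ds\,d\tau+\int_0^tF_0(\tau)\,d\tau+G\,W(t)\quad\text{for all } t\ge0.$$ The strong solution is unique: if $V'$ is another one, then almost surely $V'(t)=V(t)$ for all $t\ge0$. (c) The strong solution is $V(t)=r(t)V_0+\int_0^tr(t-s)F(s)\,ds$, that is, for every $t\ge0$, almost surely $$V(t)=r(t)V_0+\int_0^tr(t-s)F_0(s)\,ds+\int_0^tr(t-s)G\,dW(s),$$ where the last term is the Wiener integral (the mean-square limit of the integrals of deterministic step functions converging to $s\mapsto r(t-s)G$ in $L^2(0,t)$). -/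

import Mathlib

open MeasureTheory ProbabilityTheory Filter Set Topology
open scoped NNReal ENNReal Matrix.Norms.L2Operator

/-- The action of a real `d × d` matrix on the Euclidean space `ℝᵈ`. -/
notation:73 A:74 " ∙ᵥ " x:73 => Matrix.toEuclideanCLM (𝕜 := ℝ) A x

/-- `r` is a differential resolvent of `D` and `γ`: `r(0) = I` and
`r'(t) = -D r(t) - ∫₀ᵗ γ(t-s) r(s) ds` for every `t ≥ 0` (one-sided derivative at `t = 0`).
The values of `γ` and `r` at negative times play no role. -/
structure IsDifferentialResolvent {d : ℕ} (D : Matrix (Fin d) (Fin d) ℝ)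
    (γ r : ℝ → Matrix (Fin d) (Fin d) ℝ) : Prop where
  initial : r 0 = 1
  deriv : ∀ t : ℝ, 0 ≤ t →
    HasDerivWithinAt r (-(D * r t) - ∫ s in (0 : ℝ)..t, γ (t - s) * r s) (Ici 0) t

/-- A standard `d`-dimensional Brownian motion: the coordinates are independent standard real
Brownian motions. -/
structure IsBrownianMotion {Ω : Type*} [MeasurableSpace Ω] {d : ℕ}
    (W : ℝ≥0 → Ω → EuclideanSpace ℝ (Fin d)) (P : Measure Ω) : Prop where
  coord : ∀ i : Fin d, IsBrownianReal (fun t ω => W t ω i) P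
  indep : iIndepFun (fun (i : Fin d) (ω : Ω) (t : ℝ≥0) => W t ω i) P

/-- `X`, restricted to times `t ≥ 0`, is mean-square bounded and mean-square continuous. -/
structure IsMeanSquareBoundedContinuous {Ω : Type*} [MeasurableSpace Ω] {d : ℕ}
    (X : ℝ → Ω → EuclideanSpace ℝ (Fin d)) (P : Measure Ω) : Prop where
  bounded : ∃ C : ℝ≥0, ∀ t : ℝ, 0 ≤ t → eLpNorm (X t) 2 P ≤ C
  continuous : ∀ t : ℝ, 0 ≤ t →
    Tendsto (fun s => eLpNorm (fun ω => X s ω - X t ω) 2 P) (𝓝[Ici 0] t) (𝓝 0)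

/-- A deterministic matrix-valued step function on `(0, T]`, that is, a finite sum of the functions
`coeff i * 1_(left i, right i]` with `0 ≤ left i ≤ right i ≤ T`. -/
structure MatrixStep (d : ℕ) (T : ℝ≥0) where
  /-- number of summands -/
  n : ℕ
  /-- left end points -/
  left : Fin n → ℝ≥0
  /-- right end points -/
  right : Fin n → ℝ≥0
  /-- coefficients -/
  coeff : Fin n → Matrix (Fin d) (Fin d) ℝ
  left_le_right : ∀ i, left i ≤ right i
  right_le : ∀ i, right i ≤ T

/-- The step function as a function of time. -/
noncomputable def MatrixStep.toFun {d : ℕ} {T : ℝ≥0} (φ : MatrixStep d T) (s : ℝ) :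
    Matrix (Fin d) (Fin d) ℝ :=
  ∑ i, (Ioc (φ.left i : ℝ) (φ.right i : ℝ)).indicator (fun _ => φ.coeff i) s

/-- The integral of a step function against the increments of `W`. -/
noncomputable def MatrixStep.integral {Ω : Type*} {d : ℕ} {T : ℝ≥0} (φ : MatrixStep d T)
    (W : ℝ≥0 → Ω → EuclideanSpace ℝ (Fin d)) (ω : Ω) : EuclideanSpace ℝ (Fin d) :=
  ∑ i, φ.coeff i ∙ᵥ (W (φ.right i) ω - W (φ.left i) ω)

/-- `Y` is (a version of) the Wiener integral `∫₀ᵀ f(s) dW(s)` of the deterministic matrix-valued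
`f ∈ L²(0, T)`: the mean-square limit of the integrals of step functions that converge to `f`
in `L²(0, T)`. -/
structure IsWienerIntegral {Ω : Type*} [MeasurableSpace Ω] {d : ℕ} (P : Measure Ω)
    (W : ℝ≥0 → Ω → EuclideanSpace ℝ (Fin d)) (f : ℝ → Matrix (Fin d) (Fin d) ℝ) (T : ℝ≥0)
    (Y : Ω → EuclideanSpace ℝ (Fin d)) : Prop where
  memLp_integrand : MemLp f 2 (volume.restrict (Ioc (0 : ℝ) T))
  memLp_integral : MemLp Y 2 P
  limit : ∃ φ : ℕ → MatrixStep d T,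
    Tendsto (fun n => eLpNorm (fun s => (φ n).toFun s - f s) 2 (volume.restrict (Ioc (0 : ℝ) T)))
      atTop (𝓝 0) ∧
    Tendsto (fun n => eLpNorm (fun ω => (φ n).integral W ω - Y ω) 2 P) atTop (𝓝 0)

/-- `V` is a strong solution of the generalized Langevin equation
`dV/dt = -D V(t) - ∫₀ᵗ γ(t-s) V(s) ds + F(t)`, `V(0) = V₀`, with `F = F₀ + G dW/dt`:
almost every path satisfies the time-integrated equation at all times `t ≥ 0`, where the time
integral of `F` is `∫₀ᵗ F₀(τ) dτ + G W(t)`. -/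
structure IsStrongSolution {Ω : Type*} [MeasurableSpace Ω] {d : ℕ} (P : Measure Ω)
    (D : Matrix (Fin d) (Fin d) ℝ) (γ : ℝ → Matrix (Fin d) (Fin d) ℝ)
    (V₀ : Ω → EuclideanSpace ℝ (Fin d)) (F₀ : ℝ → Ω → EuclideanSpace ℝ (Fin d))
    (G : Matrix (Fin d) (Fin d) ℝ) (W : ℝ≥0 → Ω → EuclideanSpace ℝ (Fin d))
    (V : ℝ → Ω → EuclideanSpace ℝ (Fin d)) : Prop where
  aemeasurable : ∀ t : ℝ, 0 ≤ t → AEMeasurable (V t) P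
  locallyIntegrable_force : ∀ᵐ ω ∂P, LocallyIntegrableOn (fun s => F₀ s ω) (Ici 0)
  locallyIntegrable : ∀ᵐ ω ∂P, LocallyIntegrableOn (fun s => V s ω) (Ici 0)
  equation : ∀ᵐ ω ∂P, ∀ t : ℝ≥0,
    V t ω = V₀ ω - (D ∙ᵥ ∫ s in (0 : ℝ)..t, V s ω)
      - (∫ τ in (0 : ℝ)..t, ∫ s in (0 : ℝ)..τ, γ (τ - s) ∙ᵥ V s ω)
      + ((∫ τ in (0 : ℝ)..t, F₀ τ ω) + G ∙ᵥ W t ω)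

/-! Write `*` for causal convolution. Since `γ` is only locally integrable, the equation is first
integrated in time: with the continuous kernel `k(t) = D + ∫₀ᵗ γ`, it becomes the Volterra equation
`x + k * x = f` with `f = V₀ + ∫ F₀ + G W`, path by path (`drift_integral_eq_causalConv`).
Probability is irrelevant for existence and uniqueness, so no joint law is needed.

Picard iteration produces the resolvent kernel `ρ = -k - k * ρ` (`exists_volterra_solution`). Then
`x = f + ρ * f` solves the Volterra equation, because `k * f + (k * ρ) * f = -ρ * f`
(`causalConv_kernel_solution`). The same factorial estimate that makes the iteration converge forces
a solution with zero forcing to vanish (`eq_zero_of_eq_neg_causalConv`). The differential resolvent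
is `r = 1 + ∫ ρ`, and its uniqueness is Volterra uniqueness with matrices in place of vectors.

In `f + ρ * f` the constant `V₀` gives `r V₀` and the primitive of `F₀` gives `r * F₀`. The Brownian
part gives `G W(t) + ∫₀ᵗ ρ(t-s) G W(s) ds`, which is the Wiener integral of `r(t-s) G` after
integration by parts. `IsBrownianMotion.isWienerIntegral_of_primitive` proves this by summation by
parts on uniform partitions: each interval of length `h` contributes a mean-square error of order
`h^(3/2)`, hence `h^(1/2)` in total. -/

theorem indicator_Icc_zero_of_neg {E : Type*} [NormedAddCommGroup E] (a : ℝ → E)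
    (T : ℝ) (s : ℝ) (hs : s < 0) :
    (Icc 0 T).indicator a s = 0 :=
  indicator_of_notMem (fun h => (h.1.trans_lt hs).false) _

theorem eqOn_indicator_Icc {E : Type*} [NormedAddCommGroup E] (a : ℝ → E) {T t : ℝ} (h : t ≤ T) :
    EqOn ((Icc 0 T).indicator a) a (Icc 0 t) :=
  fun _ hs => indicator_of_mem (show _ ∈ Icc 0 T from ⟨hs.1, hs.2.trans h⟩) _

theorem norm_indicator_le_of_bounded {E : Type*} [NormedAddCommGroup E] {a : ℝ → E}
    {s : Set ℝ} {C : ℝ} (h : ∀ x ∈ s, ‖a x‖ ≤ C)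
    (x : ℝ) : ‖s.indicator a x‖ ≤ |C| := by
  by_cases hx : x ∈ s
  · rw [indicator_of_mem hx]; exact (h x hx).trans (le_abs_self C)
  · rw [indicator_of_notMem hx]; simp

/-! ### Causal convolution and its associativity -/

section CausalConvolution

variable {E₁ E₂ E₃ F₁₂ F₂₃ F : Type*} [NormedAddCommGroup E₁] [NormedSpace ℝ E₁]
  [NormedAddCommGroup E₂] [NormedSpace ℝ E₂] [NormedAddCommGroup E₃] [NormedSpace ℝ E₃]
  [NormedAddCommGroup F₁₂] [NormedSpace ℝ F₁₂] [NormedAddCommGroup F₂₃] [NormedSpace ℝ F₂₃]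
  [NormedAddCommGroup F] [NormedSpace ℝ F]

/-- The causal convolution `∫₀ᵗ B(a(t-s), x(s)) ds` with respect to a bilinear map `B`. -/
noncomputable def causalConv (B : E₁ →L[ℝ] E₂ →L[ℝ] F) (a : ℝ → E₁) (x : ℝ → E₂) (t : ℝ) : F :=
  ∫ s in (0 : ℝ)..t, B (a (t - s)) (x s)

theorem convolution_eq_causalConv (B : E₁ →L[ℝ] E₂ →L[ℝ] F) {f a : ℝ → E₁} {g b : ℝ → E₂} {t : ℝ}
    (ht : 0 ≤ t) (hf₀ : ∀ s < 0, f s = 0) (hf : EqOn f a (Icc 0 t))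
    (hg₀ : ∀ s < 0, g s = 0) (hg : EqOn g b (Icc 0 t)) :
    convolution f g B volume t = causalConv B a b t := by
  rw [convolution_eq_swap, causalConv, intervalIntegral.integral_of_le ht,
    ← integral_Icc_eq_integral_Ioc, ← integral_indicator measurableSet_Icc]
  congr 1 with s
  by_cases hs : s ∈ Icc 0 t
  · rw [indicator_of_mem hs, hg hs, hf ⟨sub_nonneg.2 hs.2, by linarith [hs.1]⟩]
  · rw [indicator_of_notMem hs]
    rcases lt_or_ge s 0 with h | h
    · simp [hg₀ s h]
    · have : t < s := not_le.1 fun h' => hs ⟨h, h'⟩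
      simp [hf₀ (t - s) (by linarith)]

theorem convolution_eq_zero_of_neg (B : E₁ →L[ℝ] E₂ →L[ℝ] F) {f : ℝ → E₁} {g : ℝ → E₂} {t : ℝ}
    (ht : t < 0) (hf₀ : ∀ s < 0, f s = 0) (hg₀ : ∀ s < 0, g s = 0) :
    convolution f g B volume t = 0 := by
  rw [convolution_def]
  refine integral_eq_zero_of_ae (Eventually.of_forall fun s => ?_)
  rcases lt_or_ge s 0 with h | h
  · simp [hf₀ s h]
  · simp [hg₀ (t - s) (by linarith)]

theorem convolution_indicator_eq_causalConv (B : E₁ →L[ℝ] E₂ →L[ℝ] F) (a : ℝ → E₁) (b : ℝ → E₂)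
    {t T : ℝ} (ht : 0 ≤ t) (hT : t ≤ T) :
    convolution ((Icc 0 T).indicator a) ((Icc 0 T).indicator b) B volume t = causalConv B a b t :=
  convolution_eq_causalConv B ht (indicator_Icc_zero_of_neg a T) (eqOn_indicator_Icc a hT)
    (indicator_Icc_zero_of_neg b T) (eqOn_indicator_Icc b hT)

theorem integrableOn_causalConv (B : E₁ →L[ℝ] E₂ →L[ℝ] F) {a : ℝ → E₁} {b : ℝ → E₂} {T : ℝ}
    (ha : IntegrableOn a (Icc 0 T)) (hb : IntegrableOn b (Icc 0 T)) :
    IntegrableOn (causalConv B a b) (Icc 0 T) := by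
  have h := (ha.integrable_indicator measurableSet_Icc).integrable_convolution B
    (hb.integrable_indicator measurableSet_Icc)
  exact h.integrableOn.congr_fun
    (fun t ht => convolution_indicator_eq_causalConv B a b ht.1 ht.2) measurableSet_Icc

variable [CompleteSpace F₁₂] [CompleteSpace F₂₃] [CompleteSpace F]
  {L : E₁ →L[ℝ] E₂ →L[ℝ] F₁₂} {L₂ : F₁₂ →L[ℝ] E₃ →L[ℝ] F}
  {L₃ : E₁ →L[ℝ] F₂₃ →L[ℝ] F} {L₄ : E₂ →L[ℝ] E₃ →L[ℝ] F₂₃}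
  {a : ℝ → E₁} {b : ℝ → E₂} {c : ℝ → E₃} {t : ℝ}

/-- Extension by zero turns causal convolutions into convolutions on the line. For integrable
functions the triple convolution exists only almost everywhere, while the identity is wanted at
every `t`; existence at `t` is therefore a hypothesis, which a bound on one factor supplies below.
-/
theorem causalConv_assoc_of_exists (hL : ∀ x y z, L₂ (L x y) z = L₃ x (L₄ y z)) (ht : 0 ≤ t)
    (ha : IntegrableOn a (Icc 0 t)) (hb : IntegrableOn b (Icc 0 t)) (hc : IntegrableOn c (Icc 0 t))
    (h : ConvolutionExistsAt (fun s => ‖(Icc 0 t).indicator a s‖)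
      (convolution (fun s => ‖(Icc 0 t).indicator b s‖) (fun s => ‖(Icc 0 t).indicator c s‖)
        (ContinuousLinearMap.mul ℝ ℝ) volume) t (ContinuousLinearMap.mul ℝ ℝ) volume) :
    causalConv L₂ (causalConv L a b) c t = causalConv L₃ a (causalConv L₄ b c) t := by
  have ha' := ha.integrable_indicator measurableSet_Icc
  have hb' := hb.integrable_indicator measurableSet_Icc
  have hc' := hc.integrable_indicator measurableSet_Icc
  have key := convolution_assoc L L₂ L₃ L₄ hL ha'.aestronglyMeasurable hb'.aestronglyMeasurable
    hc'.aestronglyMeasurable (ha'.ae_convolution_exists L hb')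
    (hb'.norm.ae_convolution_exists (ContinuousLinearMap.mul ℝ ℝ) hc'.norm) h
  rw [convolution_eq_causalConv L₂ (a := causalConv L a b) (b := c) ht
    (fun s hs => convolution_eq_zero_of_neg L hs (indicator_Icc_zero_of_neg a t)
      (indicator_Icc_zero_of_neg b t))
    (fun s hs => convolution_indicator_eq_causalConv L a b hs.1 hs.2)
    (indicator_Icc_zero_of_neg c t) (eqOn_indicator_Icc c le_rfl)] at key
  rw [key]
  exact convolution_eq_causalConv L₃ ht (indicator_Icc_zero_of_neg a t)
    (eqOn_indicator_Icc a le_rfl)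
    (fun s hs => convolution_eq_zero_of_neg L₄ hs (indicator_Icc_zero_of_neg b t)
      (indicator_Icc_zero_of_neg c t))
    (fun s hs => convolution_indicator_eq_causalConv L₄ b c hs.1 hs.2)

theorem causalConv_assoc_of_bounded_left (hL : ∀ x y z, L₂ (L x y) z = L₃ x (L₄ y z)) (ht : 0 ≤ t)
    (ha : IntegrableOn a (Icc 0 t)) (hb : IntegrableOn b (Icc 0 t)) (hc : IntegrableOn c (Icc 0 t))
    {C : ℝ} (hC : ∀ s ∈ Icc 0 t, ‖a s‖ ≤ C) :
    causalConv L₂ (causalConv L a b) c t = causalConv L₃ a (causalConv L₄ b c) t := by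
  refine causalConv_assoc_of_exists hL ht ha hb hc ?_
  have ha' := ha.integrable_indicator measurableSet_Icc
  have hb' := hb.integrable_indicator measurableSet_Icc
  have hc' := hc.integrable_indicator measurableSet_Icc
  refine ContinuousLinearMap.integrable_of_bilin_of_bdd_left _ |C|
    ha'.norm.aestronglyMeasurable (Eventually.of_forall fun s => ?_)
    ((hb'.norm.integrable_convolution (ContinuousLinearMap.mul ℝ ℝ) hc'.norm).comp_sub_left t)
  simpa using norm_indicator_le_of_bounded hC s

/-- Here `|b| * |c|` is bounded by `|C| ∫ |c|` at every point, so it is integrable against `a`. This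
serves the case where both outer factors may be merely integrable. -/
theorem causalConv_assoc_of_bounded_middle (hL : ∀ x y z, L₂ (L x y) z = L₃ x (L₄ y z))
    (ht : 0 ≤ t) (ha : IntegrableOn a (Icc 0 t)) (hb : IntegrableOn b (Icc 0 t))
    (hc : IntegrableOn c (Icc 0 t)) {C : ℝ} (hC : ∀ s ∈ Icc 0 t, ‖b s‖ ≤ C) :
    causalConv L₂ (causalConv L a b) c t = causalConv L₃ a (causalConv L₄ b c) t := by
  refine causalConv_assoc_of_exists hL ht ha hb hc ?_
  have ha' := ha.integrable_indicator measurableSet_Icc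
  have hb' := hb.integrable_indicator measurableSet_Icc
  have hc' := hc.integrable_indicator measurableSet_Icc
  have hconv := hb'.norm.integrable_convolution (ContinuousLinearMap.mul ℝ ℝ) hc'.norm
  refine ContinuousLinearMap.integrable_of_bilin_of_bdd_right _
    (|C| * ∫ s, ‖(Icc 0 t).indicator c s‖) ha'.norm ?_ (Eventually.of_forall fun s => ?_)
  · exact (hconv.comp_sub_left t).aestronglyMeasurable
  · rw [convolution_def, ← integral_sub_left_eq_self (fun u => ‖(Icc 0 t).indicator c u‖) volume (t - s),
      ← integral_const_mul]
    refine norm_integral_le_of_norm_le ((hc'.norm.comp_sub_left (t - s)).const_mul |C|)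
      (Eventually.of_forall fun u => ?_)
    simp only [ContinuousLinearMap.mul_apply', norm_mul, norm_norm]
    gcongr
    exact norm_indicator_le_of_bounded hC u

end CausalConvolution

/-! ### Picard iteration for Volterra equations with continuous kernel -/

section IteratedBounds

/-- Each step integrates `s ^ n / n!` once more. The lemma serves twice: for the Picard iterates,
and for a constant sequence in the uniqueness proof. -/
theorem norm_le_pow_div_factorial {E : Type*} [NormedAddCommGroup E] {x : ℕ → ℝ → E} {C M T : ℝ}
    (hC : 0 ≤ C) (hint : ∀ n, IntegrableOn (x n) (Icc 0 T))
    (h₀ : ∀ t ∈ Icc 0 T, ‖x 0 t‖ ≤ M)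
    (hstep : ∀ n, ∀ t ∈ Icc 0 T, ‖x (n + 1) t‖ ≤ C * ∫ s in (0 : ℝ)..t, ‖x n s‖) (n : ℕ) :
    ∀ t ∈ Icc 0 T, ‖x n t‖ ≤ M * ((C * t) ^ n / n.factorial) := by
  induction n with
  | zero => intro t ht; simpa using h₀ t ht
  | succ n ih =>
    intro t ht
    have hsub : Icc 0 t ⊆ Icc 0 T := Icc_subset_Icc_right ht.2
    have hle : ∫ s in (0 : ℝ)..t, ‖x n s‖ ≤
        ∫ s in (0 : ℝ)..t, M * ((C * s) ^ n / n.factorial) := by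
      refine intervalIntegral.integral_mono_on ht.1 ?_ ?_ fun s hs => ih s (hsub hs)
      · exact (intervalIntegrable_iff_integrableOn_Icc_of_le ht.1).2 ((hint n).mono_set hsub).norm
      · exact Continuous.intervalIntegrable (by fun_prop) _ _
    refine (hstep n t ht).trans ((mul_le_mul_of_nonneg_left hle hC).trans_eq ?_)
    have : ∀ s : ℝ, M * ((C * s) ^ n / n.factorial) = (M * C ^ n / n.factorial) * s ^ n := by
      intro s; rw [mul_pow]; ring
    simp_rw [this, intervalIntegral.integral_const_mul, integral_pow, Nat.factorial_succ]
    push_cast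
    have h1 : (n.factorial : ℝ) ≠ 0 := by positivity
    have h2 : (n : ℝ) + 1 ≠ 0 := by positivity
    field_simp
    ring

theorem Continuous.exists_norm_le_Icc {E : Type*} [NormedAddCommGroup E] {f : ℝ → E}
    (hf : Continuous f) (T : ℝ) : ∃ C : ℝ, 0 ≤ C ∧ ∀ s ∈ Icc 0 T, ‖f s‖ ≤ C := by
  obtain ⟨C, hC⟩ := isCompact_Icc.exists_bound_of_continuousOn (s := Icc 0 T) hf.continuousOn
  exact ⟨max C 0, le_max_right _ _, fun s hs => (hC s hs).trans (le_max_left _ _)⟩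

end IteratedBounds

section Volterra

variable {A E : Type*} [NormedRing A] [NormedAlgebra ℝ A] [NormedAddCommGroup E] [NormedSpace ℝ E]
  {B : A →L[ℝ] E →L[ℝ] E}

theorem intervalIntegrable_causalConv_integrand (B : A →L[ℝ] E →L[ℝ] E) {k : ℝ → A}
    (hk : Continuous k) {x : ℝ → E} {t : ℝ} (ht : 0 ≤ t) (hx : IntegrableOn x (Icc 0 t)) :
    IntervalIntegrable (fun s => B (k (t - s)) (x s)) volume 0 t := by
  rw [intervalIntegrable_iff_integrableOn_Icc_of_le ht]
  obtain ⟨C, -, hC⟩ := hk.exists_norm_le_Icc t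
  refine B.integrable_of_bilin_of_bdd_left C (Continuous.aestronglyMeasurable (by fun_prop)) ?_ hx
  exact (ae_restrict_iff' measurableSet_Icc).2 (Eventually.of_forall fun s hs =>
    hC _ ⟨sub_nonneg.2 hs.2, by linarith [hs.1]⟩)

theorem norm_causalConv_le (B : A →L[ℝ] E →L[ℝ] E) {k : ℝ → A} {x : ℝ → E} {t T C : ℝ}
    (ht : t ∈ Icc 0 T) (hC : ∀ s ∈ Icc 0 T, ‖k s‖ ≤ C) (hx : IntegrableOn x (Icc 0 T)) :
    ‖causalConv B k x t‖ ≤ ‖B‖ * C * ∫ s in (0 : ℝ)..t, ‖x s‖ := by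
  rw [← intervalIntegral.integral_const_mul]
  refine intervalIntegral.norm_integral_le_of_norm_le ht.1
    (Eventually.of_forall fun s hs => ?_) (IntervalIntegrable.const_mul ?_ _)
  · refine (B.le_opNorm₂ _ _).trans ?_
    gcongr
    exact hC _ ⟨sub_nonneg.2 hs.2, by linarith [hs.1, ht.2]⟩
  · exact (intervalIntegrable_iff_integrableOn_Icc_of_le ht.1).2
      (hx.mono_set (Icc_subset_Icc_right ht.2)).norm

theorem eq_zero_of_eq_neg_causalConv {k : ℝ → A} (hk : Continuous k) {u : ℝ → E}
    (hu : ∀ T, IntegrableOn u (Icc 0 T)) (h : ∀ t, 0 ≤ t → u t = -causalConv B k u t)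
    {t : ℝ} (ht : 0 ≤ t) : u t = 0 := by
  obtain ⟨C, hC₀, hC⟩ := hk.exists_norm_le_Icc t
  have hbound : ∀ s ∈ Icc 0 t, ‖u s‖ ≤ ‖B‖ * C * ∫ s in (0 : ℝ)..s, ‖u s‖ := fun s hs => by
    rw [h s hs.1, norm_neg]
    exact norm_causalConv_le B hs hC (hu t)
  have hint : IntervalIntegrable (fun s => ‖u s‖) volume 0 t :=
    (intervalIntegrable_iff_integrableOn_Icc_of_le ht).2 (hu t).norm
  -- The constant sequence `u` satisfies the recursive bound, so `‖u t‖` lies below `M (Ct)^n / n!`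
  -- for every `n`. No continuity of `u` is needed: `M` comes from its integral.
  have key := fun n => norm_le_pow_div_factorial (x := fun _ => u)
    (M := ‖B‖ * C * ∫ s in (0 : ℝ)..t, ‖u s‖) (by positivity) (fun _ => hu t)
    (fun s hs => (hbound s hs).trans (by
      gcongr
      exact intervalIntegral.integral_mono_interval le_rfl hs.1 hs.2
        (Eventually.of_forall fun _ => norm_nonneg _) hint))
    (fun _ => hbound) n t ⟨ht, le_rfl⟩
  have hlim := (FloorSemiring.tendsto_pow_div_factorial_atTop (‖B‖ * C * t)).const_mul
    (‖B‖ * C * ∫ s in (0 : ℝ)..t, ‖u s‖)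
  rw [mul_zero] at hlim
  exact norm_le_zero_iff.1 (ge_of_tendsto' hlim key)

theorem continuous_causalConv (B : A →L[ℝ] E →L[ℝ] E) {k : ℝ → A} {x : ℝ → E} (hk : Continuous k)
    (hx : Continuous x) : Continuous (causalConv B k x) :=
  intervalIntegral.continuous_parametric_intervalIntegral_of_continuous
    (f := fun t s => B (k (t - s)) (x s)) (by fun_prop) continuous_id

/-- The Picard iterates of the Volterra equation `x = g - k * x`. -/
noncomputable def volterraIterate (B : A →L[ℝ] E →L[ℝ] E) (k : ℝ → A) (g : ℝ → E) : ℕ → ℝ → E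
  | 0 => g
  | n + 1 => fun t => -causalConv B k (volterraIterate B k g n) t

theorem continuous_volterraIterate (B : A →L[ℝ] E →L[ℝ] E) {k : ℝ → A} {g : ℝ → E}
    (hk : Continuous k) (hg : Continuous g) : ∀ n, Continuous (volterraIterate B k g n)
  | 0 => hg
  | n + 1 => (continuous_causalConv B hk (continuous_volterraIterate B hk hg n)).neg

theorem exists_norm_volterraIterate_le (B : A →L[ℝ] E →L[ℝ] E) {k : ℝ → A} {g : ℝ → E}
    (hk : Continuous k) (hg : Continuous g) (T : ℝ) :
    ∃ u : ℕ → ℝ, Summable u ∧ ∀ n, ∀ t ∈ Icc 0 T, ‖volterraIterate B k g n t‖ ≤ u n := by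
  obtain ⟨C, hC₀, hC⟩ := hk.exists_norm_le_Icc T
  obtain ⟨M, hM₀, hM⟩ := hg.exists_norm_le_Icc T
  have hint : ∀ n, IntegrableOn (volterraIterate B k g n) (Icc 0 T) := fun n =>
    (continuous_volterraIterate B hk hg n).continuousOn.integrableOn_Icc
  refine ⟨fun n => M * ((‖B‖ * C * T) ^ n / n.factorial),
    (Real.summable_pow_div_factorial _).mul_left _, fun n t ht => ?_⟩
  refine (norm_le_pow_div_factorial (C := ‖B‖ * C) (by positivity) hint hM
    (fun n t ht => ?_) n t ht).trans ?_
  · rw [volterraIterate, norm_neg]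
    exact norm_causalConv_le B ht hC (hint n)
  · have := ht.1
    have := ht.2
    change _ ≤ M * ((‖B‖ * C * T) ^ n / n.factorial)
    gcongr

theorem exists_volterra_solution [CompleteSpace E] (B : A →L[ℝ] E →L[ℝ] E) {k : ℝ → A} {g : ℝ → E}
    (hk : Continuous k) (hg : Continuous g) :
    ∃ x : ℝ → E, Continuous x ∧ ∀ t, 0 ≤ t → x t = g t - causalConv B k x t := by
  have hcont := continuous_volterraIterate B hk hg
  -- The summable bounds hold only on `[0, T]`; freezing the iterates at negative times makes the
  -- sum continuous on all of `ℝ`.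
  refine ⟨fun t => ∑' n, volterraIterate B k g n (max t 0), ?_, fun t ht => ?_⟩
  · refine continuous_iff_continuousAt.2 fun t => ?_
    obtain ⟨u, hu, hle⟩ := exists_norm_volterraIterate_le B hk hg (max (t + 1) 0)
    refine (continuousOn_tsum (s := Iio (t + 1)) (fun n => ?_) hu fun n s hs => ?_).continuousAt
      (Iio_mem_nhds (lt_add_one t))
    · exact ((hcont n).comp (by fun_prop)).continuousOn
    · exact hle n _ ⟨le_max_right _ _, max_le_max_right 0 (le_of_lt hs)⟩
  · obtain ⟨u, hu, hle⟩ := exists_norm_volterraIterate_le B hk hg t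
    obtain ⟨C, hC₀, hC⟩ := hk.exists_norm_le_Icc t
    have hsum : ∀ s ∈ Icc 0 t, HasSum (fun n => volterraIterate B k g n s)
        (∑' n, volterraIterate B k g n (max s 0)) := fun s hs => by
      rw [max_eq_left hs.1]
      exact (Summable.of_norm_bounded hu fun n => hle n s hs).hasSum
    have hconv : HasSum (fun n => causalConv B k (volterraIterate B k g n) t)
        (causalConv B k (fun t => ∑' n, volterraIterate B k g n (max t 0)) t) := by
      refine intervalIntegral.hasSum_integral_of_dominated_convergence
        (fun n _ => ‖B‖ * C * u n) (fun n => ?_) (fun n => ?_) ?_ ?_ ?_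
      · have := hcont n
        exact Continuous.aestronglyMeasurable (by fun_prop)
      · refine Eventually.of_forall fun s hs => (B.le_opNorm₂ _ _).trans ?_
        rw [uIoc_of_le ht] at hs
        gcongr
        · exact hC _ ⟨sub_nonneg.2 hs.2, by linarith [hs.1]⟩
        · exact hle n s (Ioc_subset_Icc_self hs)
      · exact Eventually.of_forall fun _ _ => hu.mul_left _
      · exact intervalIntegrable_const
      · refine Eventually.of_forall fun s hs => ?_
        rw [uIoc_of_le ht] at hs
        exact (hsum s (Ioc_subset_Icc_self hs)).mapL (B (k (t - s)))
    have h₁ := (hsum t ⟨ht, le_rfl⟩)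
    -- Without its zeroth term `g`, the series is termwise `-k *` the full series.
    have h₂ := (hasSum_nat_add_iff' 1).2 h₁
    simp only [volterraIterate, Finset.range_one, Finset.sum_singleton] at h₂
    have h₃ := h₂.unique hconv.neg
    exact (sub_eq_iff_eq_add'.1 h₃).trans (sub_eq_add_neg _ _).symm

end Volterra

/-! ### The integrated kernel and its resolvent kernel -/

section Resolvent

variable {A E : Type*} [NormedRing A] [NormedAlgebra ℝ A]
  [NormedAddCommGroup E] [NormedSpace ℝ E] {B : A →L[ℝ] E →L[ℝ] E}

/-- Nothing is assumed on `γ` at negative times, so it is cut off there to make `k` continuous on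
the whole line. -/
theorem exists_continuous_memory_primitive (D : A) {γ : ℝ → A}
    (hγ : ∀ T, IntegrableOn γ (Icc 0 T)) :
    ∃ k : ℝ → A, Continuous k ∧ ∀ t, 0 ≤ t → k t = D + ∫ s in (0 : ℝ)..t, γ s := by
  refine ⟨fun t => D + ∫ s in (0 : ℝ)..t, (Ici (0 : ℝ)).indicator γ s, ?_, fun t ht => ?_⟩
  · refine continuous_const.add (intervalIntegral.continuous_primitive (fun a b => ?_) 0)
    rw [intervalIntegrable_iff]
    refine (integrable_indicator_iff measurableSet_Ici).2 ?_
    rw [IntegrableOn, Measure.restrict_restrict measurableSet_Ici]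
    exact (hγ (max a b)).mono_set fun s hs => ⟨hs.1, hs.2.2⟩
  · dsimp only
    congr 1
    refine intervalIntegral.integral_congr fun s hs => ?_
    rw [uIcc_of_le ht] at hs
    exact indicator_of_mem (show s ∈ Ici 0 from hs.1) _

theorem causalConv_one_left (B : A →L[ℝ] E →L[ℝ] E) (hB₁ : ∀ x, B 1 x = x) (x : ℝ → E) (t : ℝ) :
    causalConv B (fun _ => 1) x t = ∫ s in (0 : ℝ)..t, x s := by
  simp [causalConv, hB₁]

theorem causalConv_mul_one_right (γ : ℝ → A) (t : ℝ) :
    causalConv (ContinuousLinearMap.mul ℝ A) γ (fun _ => 1) t = ∫ s in (0 : ℝ)..t, γ s := by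
  simp [causalConv]

variable [CompleteSpace A] [CompleteSpace E]

/-- Integrating the drift in time turns the memory kernel into its primitive. -/
theorem drift_integral_eq_causalConv (hB : ∀ a b x, B (a * b) x = B a (B b x))
    (hB₁ : ∀ x, B 1 x = x) {D : A} {γ k : ℝ → A} (hk : Continuous k)
    (hkγ : ∀ t, 0 ≤ t → k t = D + ∫ s in (0 : ℝ)..t, γ s) (hγ : ∀ T, IntegrableOn γ (Icc 0 T))
    {x : ℝ → E} {t : ℝ} (ht : 0 ≤ t) (hx : IntegrableOn x (Icc 0 t)) :
    B D (∫ s in (0 : ℝ)..t, x s) + ∫ τ in (0 : ℝ)..t, ∫ s in (0 : ℝ)..τ, B (γ (τ - s)) (x s) =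
      causalConv B k x t := by
  -- The double integral is `1 * (γ * x) = (1 * γ) * x`, and `1 * γ = k - D`.
  have h₁ : ∫ τ in (0 : ℝ)..t, ∫ s in (0 : ℝ)..τ, B (γ (τ - s)) (x s) =
      causalConv B (causalConv (ContinuousLinearMap.mul ℝ A) (fun _ => 1) γ) x t := by
    rw [causalConv_assoc_of_bounded_left (L₃ := B) (L₄ := B) (by simpa using hB) ht
      (by simp) (hγ t) hx (C := ‖(1 : A)‖) (fun _ _ => le_rfl), causalConv_one_left B hB₁]
    rfl
  have h₂ : causalConv B (causalConv (ContinuousLinearMap.mul ℝ A) (fun _ => 1) γ) x t =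
      ∫ s in (0 : ℝ)..t, (B (k (t - s)) (x s) - B D (x s)) := by
    refine intervalIntegral.integral_congr fun s hs => ?_
    rw [uIcc_of_le ht] at hs
    rw [causalConv_one_left _ (by simp), hkγ _ (sub_nonneg.2 hs.2), map_add,
      add_apply, add_sub_cancel_left]
  have hxi : IntervalIntegrable x volume 0 t :=
    (intervalIntegrable_iff_integrableOn_Icc_of_le ht).2 hx
  rw [h₁, h₂, intervalIntegral.integral_sub (intervalIntegrable_causalConv_integrand B hk ht hx)
    ⟨(B D).integrable_comp hxi.1, (B D).integrable_comp hxi.2⟩,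
    ContinuousLinearMap.intervalIntegral_comp_comm _ hxi]
  exact add_sub_cancel _ _

/-- If `ρ` is the resolvent kernel of `k`, then `f + ρ * f` solves `x + k * x = f`. -/
theorem causalConv_kernel_solution (hB : ∀ a b x, B (a * b) x = B a (B b x)) {k ρ : ℝ → A}
    (hk : Continuous k) (hρ : Continuous ρ)
    (hρk : ∀ t, 0 ≤ t → ρ t = -k t - causalConv (ContinuousLinearMap.mul ℝ A) k ρ t)
    {f : ℝ → E} {t : ℝ} (ht : 0 ≤ t) (hf : IntegrableOn f (Icc 0 t)) :
    causalConv B k (fun s => f s + causalConv B ρ f s) t = -causalConv B ρ f t := by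
  obtain ⟨C, -, hC⟩ := hk.exists_norm_le_Icc t
  have hρf : IntegrableOn (causalConv B ρ f) (Icc 0 t) :=
    integrableOn_causalConv B hρ.continuousOn.integrableOn_Icc hf
  have h₁ : causalConv B k (fun s => f s + causalConv B ρ f s) t =
      causalConv B k f t + causalConv B k (causalConv B ρ f) t := by
    simp only [causalConv, map_add]
    exact intervalIntegral.integral_add (intervalIntegrable_causalConv_integrand B hk ht hf)
      (intervalIntegrable_causalConv_integrand B hk ht hρf)
  rw [h₁, ← causalConv_assoc_of_bounded_left (L := ContinuousLinearMap.mul ℝ A) (L₂ := B)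
    (by simpa using hB) ht hk.continuousOn.integrableOn_Icc hρ.continuousOn.integrableOn_Icc hf hC]
  have h₂ : causalConv B (causalConv (ContinuousLinearMap.mul ℝ A) k ρ) f t =
      -((∫ s in (0 : ℝ)..t, B (k (t - s)) (f s)) + ∫ s in (0 : ℝ)..t, B (ρ (t - s)) (f s)) := by
    rw [← intervalIntegral.integral_add (intervalIntegrable_causalConv_integrand B hk ht hf)
      (intervalIntegrable_causalConv_integrand B hρ ht hf), ← intervalIntegral.integral_neg]
    refine intervalIntegral.integral_congr fun s hs => ?_
    rw [uIcc_of_le ht] at hs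
    have : causalConv (ContinuousLinearMap.mul ℝ A) k ρ (t - s) = -(k (t - s) + ρ (t - s)) := by
      rw [hρk _ (sub_nonneg.2 hs.2)]
      abel
    simp [this]
  rw [h₂]
  simp only [causalConv]
  abel

/-- Convolving a primitive with the resolvent kernel gives the convolution with the resolvent. -/
theorem integral_add_causalConv_integral (hB : ∀ a b x, B (a * b) x = B a (B b x))
    (hB₁ : ∀ x, B 1 x = x) {ρ : ℝ → A} (hρ : Continuous ρ) {F : ℝ → E} {t : ℝ} (ht : 0 ≤ t)
    (hF : IntegrableOn F (Icc 0 t)) :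
    (∫ s in (0 : ℝ)..t, F s) + causalConv B ρ (fun τ => ∫ s in (0 : ℝ)..τ, F s) t =
      causalConv B (fun t => 1 + ∫ s in (0 : ℝ)..t, ρ s) F t := by
  have hprim : Continuous fun t => ∫ s in (0 : ℝ)..t, ρ s :=
    intervalIntegral.continuous_primitive (fun _ _ => hρ.intervalIntegrable _ _) 0
  have h₁ : (fun τ => ∫ s in (0 : ℝ)..τ, F s) = causalConv B (fun _ => 1) F :=
    funext fun τ => (causalConv_one_left B hB₁ F τ).symm
  -- The primitive is `1 * F`, so the second term is `ρ * (1 * F) = (ρ * 1) * F` with bounded middle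
  -- factor `1`.
  rw [h₁, ← causalConv_assoc_of_bounded_middle (L := ContinuousLinearMap.mul ℝ A) (L₂ := B)
    (by simpa using hB) ht hρ.continuousOn.integrableOn_Icc (by simp) hF
    (C := ‖(1 : A)‖) (fun _ _ => le_rfl), ← causalConv_one_left B hB₁,
    funext (causalConv_mul_one_right ρ)]
  simp only [causalConv]
  rw [← intervalIntegral.integral_add
    (intervalIntegrable_causalConv_integrand B continuous_const ht hF)
    (intervalIntegrable_causalConv_integrand B hprim ht hF)]
  simp

/-- The resolvent kernel of `D + ∫ γ` is the right-hand side of the resolvent equation. -/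
theorem resolvent_kernel_eq {D : A} {γ k ρ : ℝ → A} (hk : Continuous k) (hρ : Continuous ρ)
    (hkγ : ∀ t, 0 ≤ t → k t = D + ∫ s in (0 : ℝ)..t, γ s) (hγ : ∀ T, IntegrableOn γ (Icc 0 T))
    (hρk : ∀ t, 0 ≤ t → ρ t = -k t - causalConv (ContinuousLinearMap.mul ℝ A) k ρ t)
    {t : ℝ} (ht : 0 ≤ t) :
    ρ t = -(D * (1 + ∫ s in (0 : ℝ)..t, ρ s)) -
      ∫ s in (0 : ℝ)..t, γ (t - s) * (1 + ∫ u in (0 : ℝ)..s, ρ u) := by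
  have hprim : Continuous fun t => ∫ s in (0 : ℝ)..t, ρ s :=
    intervalIntegral.continuous_primitive (fun _ _ => hρ.intervalIntegrable _ _) 0
  have hρt : IntegrableOn ρ (Icc 0 t) := hρ.continuousOn.integrableOn_Icc
  -- As `∫ ρ = 1 * ρ`, the memory term is `γ * 1 + (γ * 1) * ρ` with `γ * 1 = k - D`; what remains
  -- is the defining equation of `ρ`.
  have h₁ : ∫ s in (0 : ℝ)..t, γ (t - s) * (1 + ∫ u in (0 : ℝ)..s, ρ u) =
      (∫ s in (0 : ℝ)..t, γ s) + causalConv (ContinuousLinearMap.mul ℝ A)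
        (causalConv (ContinuousLinearMap.mul ℝ A) γ (fun _ => 1)) ρ t := by
    have hγt : IntervalIntegrable (fun s => γ (t - s)) volume 0 t := by
      have := ((intervalIntegrable_iff_integrableOn_Icc_of_le ht).2 (hγ t)).comp_sub_left t
      simpa using this.symm
    rw [causalConv_assoc_of_bounded_middle (L₃ := ContinuousLinearMap.mul ℝ A)
      (L₄ := ContinuousLinearMap.mul ℝ A) (by simp [mul_assoc]) ht (hγ t) (by simp) hρt
      (C := ‖(1 : A)‖) (fun _ _ => le_rfl),
      funext (causalConv_one_left (ContinuousLinearMap.mul ℝ A) (by simp) ρ)]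
    simp only [mul_add, mul_one, causalConv, ContinuousLinearMap.mul_apply']
    rw [intervalIntegral.integral_add hγt (hγt.mul_continuousOn hprim.continuousOn),
      intervalIntegral.integral_comp_sub_left, sub_zero, sub_self]
  have h₂ : causalConv (ContinuousLinearMap.mul ℝ A) k ρ t = D * (∫ s in (0 : ℝ)..t, ρ s) +
      causalConv (ContinuousLinearMap.mul ℝ A)
        (causalConv (ContinuousLinearMap.mul ℝ A) γ (fun _ => 1)) ρ t := by
    have : causalConv (ContinuousLinearMap.mul ℝ A)
        (causalConv (ContinuousLinearMap.mul ℝ A) γ (fun _ => 1)) ρ t =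
        (∫ s in (0 : ℝ)..t, ContinuousLinearMap.mul ℝ A (k (t - s)) (ρ s)) -
          ∫ s in (0 : ℝ)..t, D * ρ s := by
      rw [← intervalIntegral.integral_sub
        (intervalIntegrable_causalConv_integrand (ContinuousLinearMap.mul ℝ A) hk ht hρt)
        ((hρ.intervalIntegrable _ _).const_mul D)]
      refine intervalIntegral.integral_congr fun s hs => ?_
      rw [uIcc_of_le ht] at hs
      simp only [causalConv_mul_one_right, hkγ _ (sub_nonneg.2 hs.2)]
      simp
    have hD : ∫ s in (0 : ℝ)..t, D * ρ s = D * ∫ s in (0 : ℝ)..t, ρ s :=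
      (ContinuousLinearMap.mul ℝ A D).intervalIntegral_comp_comm (hρ.intervalIntegrable _ _)
    rw [this, hD]
    exact (add_sub_cancel _ _).symm
  rw [h₁, hρk t ht, h₂, hkγ t ht]
  noncomm_ring

end Resolvent

/-! ### Uniqueness for the Volterra and resolvent equations -/

section VolterraUniqueness

variable {A E : Type*} [NormedRing A] [NormedAlgebra ℝ A] [NormedAddCommGroup E] [NormedSpace ℝ E]

theorem volterra_solution_unique (B : A →L[ℝ] E →L[ℝ] E) {k : ℝ → A} (hk : Continuous k)
    {f x y : ℝ → E} (hx : ∀ T, IntegrableOn x (Icc 0 T)) (hy : ∀ T, IntegrableOn y (Icc 0 T))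
    (hxk : ∀ t, 0 ≤ t → x t = f t - causalConv B k x t)
    (hyk : ∀ t, 0 ≤ t → y t = f t - causalConv B k y t) {t : ℝ} (ht : 0 ≤ t) : x t = y t := by
  refine sub_eq_zero.1 (eq_zero_of_eq_neg_causalConv (B := B) hk (u := fun t => x t - y t)
    (fun T => (hx T).sub (hy T)) (fun s hs => ?_) ht)
  have : causalConv B k (fun t => x t - y t) s = causalConv B k x s - causalConv B k y s := by
    simp only [causalConv, map_sub]
    exact intervalIntegral.integral_sub (intervalIntegrable_causalConv_integrand B hk hs (hx s))
      (intervalIntegrable_causalConv_integrand B hk hs (hy s))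
  rw [this, hxk s hs, hyk s hs]
  abel

/-- Integrating the differential equation moves it to the continuous kernel `k`, where Volterra
uniqueness applies. -/
theorem volterra_of_hasDerivWithinAt_resolvent [CompleteSpace A] {D : A} {γ k r : ℝ → A}
    (hd : ∀ t : ℝ, 0 ≤ t →
      HasDerivWithinAt r (-(D * r t) - ∫ s in (0 : ℝ)..t, γ (t - s) * r s) (Ici 0) t)
    (hk : Continuous k) (hkγ : ∀ t, 0 ≤ t → k t = D + ∫ s in (0 : ℝ)..t, γ s)
    (hγ : ∀ T, IntegrableOn γ (Icc 0 T)) {t : ℝ} (ht : 0 ≤ t) :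
    r t = r 0 - causalConv (ContinuousLinearMap.mul ℝ A) k r t := by
  have hrc : ContinuousOn r (Icc 0 t) :=
    fun s hs => (hd s hs.1).continuousWithinAt.mono Icc_subset_Ici_self
  have hri : IntegrableOn r (Icc 0 t) := hrc.integrableOn_Icc
  have hconv := integrableOn_causalConv (ContinuousLinearMap.mul ℝ A) (hγ t) hri
  have hri' := (intervalIntegrable_iff_integrableOn_Icc_of_le ht).2 hri
  have hconv' := (intervalIntegrable_iff_integrableOn_Icc_of_le ht).2 hconv
  have hDr : IntervalIntegrable (fun s => ContinuousLinearMap.mul ℝ A D (r s)) volume 0 t :=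
    hri'.const_mul D
  have h := intervalIntegral.integral_eq_sub_of_hasDeriv_right_of_le ht hrc
    (f' := fun s => -(ContinuousLinearMap.mul ℝ A D (r s) +
      causalConv (ContinuousLinearMap.mul ℝ A) γ r s))
    (fun s hs => by
      rw [neg_add']
      exact (hd s hs.1.le).mono ((Ioi_subset_Ioi hs.1.le).trans Ioi_subset_Ici_self))
    (hDr.add hconv').neg
  rw [intervalIntegral.integral_neg, intervalIntegral.integral_add hDr hconv',
    ContinuousLinearMap.intervalIntegral_comp_comm _ hri', neg_eq_iff_eq_neg, neg_sub] at h
  rw [← drift_integral_eq_causalConv (B := ContinuousLinearMap.mul ℝ A) (by simp [mul_assoc])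
    (by simp) hk hkγ hγ ht hri]
  change r t = r 0 - (_ + ∫ τ in (0 : ℝ)..t, causalConv (ContinuousLinearMap.mul ℝ A) γ r τ)
  rw [h, sub_sub_cancel]

theorem eq_of_hasDerivWithinAt_resolvent [CompleteSpace A] {D : A} {γ r r' : ℝ → A}
    (hγ : ∀ T, IntegrableOn γ (Icc 0 T)) (h₀ : r 0 = r' 0)
    (hd : ∀ t : ℝ, 0 ≤ t →
      HasDerivWithinAt r (-(D * r t) - ∫ s in (0 : ℝ)..t, γ (t - s) * r s) (Ici 0) t)
    (hd' : ∀ t : ℝ, 0 ≤ t →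
      HasDerivWithinAt r' (-(D * r' t) - ∫ s in (0 : ℝ)..t, γ (t - s) * r' s) (Ici 0) t)
    {t : ℝ} (ht : 0 ≤ t) : r t = r' t := by
  obtain ⟨k, hk, hkγ⟩ := exists_continuous_memory_primitive D hγ
  have hc : ∀ T, IntegrableOn r (Icc 0 T) := fun T => ContinuousOn.integrableOn_Icc
    fun s hs => (hd s hs.1).continuousWithinAt.mono Icc_subset_Ici_self
  have hc' : ∀ T, IntegrableOn r' (Icc 0 T) := fun T => ContinuousOn.integrableOn_Icc
    fun s hs => (hd' s hs.1).continuousWithinAt.mono Icc_subset_Ici_self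
  refine volterra_solution_unique (ContinuousLinearMap.mul ℝ A) hk (f := fun _ => r 0) hc hc'
    (fun s hs => volterra_of_hasDerivWithinAt_resolvent hd hk hkγ hγ hs) (fun s hs => ?_) ht
  rw [h₀]
  exact volterra_of_hasDerivWithinAt_resolvent hd' hk hkγ hγ hs

end VolterraUniqueness

theorem locallyIntegrableOn_Ici_iff {E : Type*} [NormedAddCommGroup E] {f : ℝ → E} :
    LocallyIntegrableOn f (Ici 0) ↔ ∀ T : ℝ, IntegrableOn f (Icc 0 T) := by
  refine ⟨fun h T => h.integrableOn_compact_subset Icc_subset_Ici_self isCompact_Icc, fun h => ?_⟩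
  refine (locallyIntegrableOn_iff isClosed_Ici.isLocallyClosed).2 fun K hK hKc => ?_
  obtain ⟨T, hT⟩ := hKc.bddAbove
  exact (h T).mono_set fun s hs => ⟨hK hs, hT hs⟩

/-! ### The Langevin equation along a fixed path -/

section Deterministic

variable {d : ℕ}

/-- The action of matrices on Euclidean space as a continuous bilinear map. -/
noncomputable def matrixAction (d : ℕ) :
    Matrix (Fin d) (Fin d) ℝ →L[ℝ] EuclideanSpace ℝ (Fin d) →L[ℝ] EuclideanSpace ℝ (Fin d) :=
  LinearMap.mkContinuous
    (Matrix.toEuclideanCLM (n := Fin d) (𝕜 := ℝ)).toAlgEquiv.toLinearMap 1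
    fun A => by
      rw [one_mul]
      exact (Matrix.l2_opNorm_toEuclideanCLM A).le

theorem matrixAction_apply (A : Matrix (Fin d) (Fin d) ℝ) (x : EuclideanSpace ℝ (Fin d)) :
    matrixAction d A x = A ∙ᵥ x := rfl

theorem matrixAction_mul (A B : Matrix (Fin d) (Fin d) ℝ) (x : EuclideanSpace ℝ (Fin d)) :
    matrixAction d (A * B) x = matrixAction d A (matrixAction d B x) := by
  simp only [matrixAction_apply, map_mul]
  rfl

theorem matrixAction_one (x : EuclideanSpace ℝ (Fin d)) : matrixAction d 1 x = x := by
  simp only [matrixAction_apply, map_one]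
  rfl

variable {D : Matrix (Fin d) (Fin d) ℝ} {γ k ρ : ℝ → Matrix (Fin d) (Fin d) ℝ}

theorem IsDifferentialResolvent.unique {r r' : ℝ → Matrix (Fin d) (Fin d) ℝ}
    (hr : IsDifferentialResolvent D γ r) (hr' : IsDifferentialResolvent D γ r')
    (hγ : ∀ T, IntegrableOn γ (Icc 0 T)) {t : ℝ} (ht : 0 ≤ t) : r' t = r t :=
  eq_of_hasDerivWithinAt_resolvent hγ (hr'.initial.trans hr.initial.symm) hr'.deriv hr.deriv ht

theorem isDifferentialResolvent_of_kernel (hk : Continuous k) (hρ : Continuous ρ)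
    (hkγ : ∀ t, 0 ≤ t → k t = D + ∫ s in (0 : ℝ)..t, γ s) (hγ : ∀ T, IntegrableOn γ (Icc 0 T))
    (hρk : ∀ t, 0 ≤ t → ρ t = -k t - causalConv (ContinuousLinearMap.mul ℝ _) k ρ t) :
    IsDifferentialResolvent D γ (fun t => 1 + ∫ s in (0 : ℝ)..t, ρ s) where
  initial := by simp
  deriv t ht := by
    rw [← resolvent_kernel_eq hk hρ hkγ hγ hρk ht]
    exact ((intervalIntegral.integral_hasDerivAt_right (hρ.intervalIntegrable _ _)
      (hρ.stronglyMeasurableAtFilter _ _) hρ.continuousAt).const_add 1).hasDerivWithinAt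

/-- Uniqueness for the time-integrated Langevin equation with a given forcing. -/
theorem langevin_path_unique (hγ : ∀ T, IntegrableOn γ (Icc 0 T))
    {f x y : ℝ → EuclideanSpace ℝ (Fin d)} (hx : ∀ T, IntegrableOn x (Icc 0 T))
    (hy : ∀ T, IntegrableOn y (Icc 0 T))
    (hxe : ∀ t, 0 ≤ t → x t = f t - ((D ∙ᵥ ∫ s in (0 : ℝ)..t, x s) +
      ∫ τ in (0 : ℝ)..t, ∫ s in (0 : ℝ)..τ, γ (τ - s) ∙ᵥ x s))
    (hye : ∀ t, 0 ≤ t → y t = f t - ((D ∙ᵥ ∫ s in (0 : ℝ)..t, y s) +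
      ∫ τ in (0 : ℝ)..t, ∫ s in (0 : ℝ)..τ, γ (τ - s) ∙ᵥ y s)) {t : ℝ} (ht : 0 ≤ t) :
    x t = y t := by
  obtain ⟨k, hk, hkγ⟩ := exists_continuous_memory_primitive D hγ
  refine volterra_solution_unique (matrixAction d) hk hx hy (f := f)
    (fun s hs => ?_) (fun s hs => ?_) ht
  · rw [← drift_integral_eq_causalConv matrixAction_mul matrixAction_one hk hkγ hγ hs (hx s)]
    exact hxe s hs
  · rw [← drift_integral_eq_causalConv matrixAction_mul matrixAction_one hk hkγ hγ hs (hy s)]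
    exact hye s hs

/-- The variation of constants formula solves the time-integrated Langevin equation. -/
theorem langevin_path_solution (hk : Continuous k) (hρ : Continuous ρ)
    (hkγ : ∀ t, 0 ≤ t → k t = D + ∫ s in (0 : ℝ)..t, γ s) (hγ : ∀ T, IntegrableOn γ (Icc 0 T))
    (hρk : ∀ t, 0 ≤ t → ρ t = -k t - causalConv (ContinuousLinearMap.mul ℝ _) k ρ t)
    {v₀ : EuclideanSpace ℝ (Fin d)} {F w x : ℝ → EuclideanSpace ℝ (Fin d)}
    (hF : ∀ T, IntegrableOn F (Icc 0 T)) (hw : Continuous w)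
    (hx : ∀ t, 0 ≤ t → x t = ((1 + ∫ s in (0 : ℝ)..t, ρ s) ∙ᵥ v₀) +
      (∫ s in (0 : ℝ)..t, (1 + ∫ u in (0 : ℝ)..(t - s), ρ u) ∙ᵥ F s) +
      (w t + ∫ s in (0 : ℝ)..t, ρ (t - s) ∙ᵥ w s)) :
    (∀ T, IntegrableOn x (Icc 0 T)) ∧
    ∀ t, 0 ≤ t → x t = (v₀ + (∫ s in (0 : ℝ)..t, F s) + w t) - ((D ∙ᵥ ∫ s in (0 : ℝ)..t, x s) +
      ∫ τ in (0 : ℝ)..t, ∫ s in (0 : ℝ)..τ, γ (τ - s) ∙ᵥ x s) := by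
  set f : ℝ → EuclideanSpace ℝ (Fin d) := fun t => v₀ + (∫ s in (0 : ℝ)..t, F s) + w t with hf
  have hFi : ∀ T, IntegrableOn (fun t => ∫ s in (0 : ℝ)..t, F s) (Icc 0 T) := fun T => by
    rw [← funext (causalConv_one_left (matrixAction d) matrixAction_one F)]
    exact integrableOn_causalConv (matrixAction d) (by simp) (hF T)
  have hfi : ∀ T, IntegrableOn f (Icc 0 T) := fun T =>
    (continuous_const.continuousOn.integrableOn_Icc.add (hFi T)).add
      hw.continuousOn.integrableOn_Icc
  -- Splitting `ρ * f` along the three summands of `f` identifies the variation of constants formula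
  -- with `f + ρ * f`.
  have hxf : ∀ t, 0 ≤ t → x t = f t + causalConv (matrixAction d) ρ f t := fun t ht => by
    have h₁ := integral_add_causalConv_integral (B := matrixAction d) matrixAction_mul
      matrixAction_one hρ ht (hF t)
    have h₂ : causalConv (matrixAction d) ρ (fun _ => v₀) t =
        matrixAction d (∫ s in (0 : ℝ)..t, ρ s) v₀ := by
      have := ((matrixAction d).flip v₀).intervalIntegral_comp_comm
        (hρ.intervalIntegrable (μ := volume) 0 t)
      simp only [ContinuousLinearMap.flip_apply] at this
      rw [← this, causalConv, intervalIntegral.integral_comp_sub_left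
        (fun s => matrixAction d (ρ s) v₀)]
      simp
    have h₃ : causalConv (matrixAction d) ρ f t = causalConv (matrixAction d) ρ (fun _ => v₀) t +
        causalConv (matrixAction d) ρ (fun τ => ∫ s in (0 : ℝ)..τ, F s) t +
        causalConv (matrixAction d) ρ w t := by
      have i₁ := intervalIntegrable_causalConv_integrand (matrixAction d) hρ ht
        (x := fun _ => v₀) continuous_const.continuousOn.integrableOn_Icc
      have i₂ := intervalIntegrable_causalConv_integrand (matrixAction d) hρ ht (hFi t)
      have i₃ := intervalIntegrable_causalConv_integrand (matrixAction d) hρ ht (x := w)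
        hw.continuousOn.integrableOn_Icc
      simp only [causalConv, hf, map_add]
      rw [intervalIntegral.integral_add (i₁.add i₂) i₃, intervalIntegral.integral_add i₁ i₂]
    have h₄ : ((1 + ∫ s in (0 : ℝ)..t, ρ s) ∙ᵥ v₀) =
        v₀ + matrixAction d (∫ s in (0 : ℝ)..t, ρ s) v₀ := by
      rw [← matrixAction_apply, map_add, add_apply, matrixAction_one]
    rw [hx t ht, h₃, h₂, h₄]
    change _ + causalConv (matrixAction d) (fun t => 1 + ∫ s in (0 : ℝ)..t, ρ s) F t +
      (w t + causalConv (matrixAction d) ρ w t) = _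
    rw [← h₁]
    simp only [hf]
    abel
  have hxi : ∀ T, IntegrableOn x (Icc 0 T) := fun T =>
    ((hfi T).add (integrableOn_causalConv (matrixAction d) hρ.continuousOn.integrableOn_Icc
      (hfi T))).congr_fun (fun t ht => (hxf t ht.1).symm) measurableSet_Icc
  refine ⟨hxi, fun t ht => ?_⟩
  have h := drift_integral_eq_causalConv matrixAction_mul matrixAction_one hk hkγ hγ ht (hxi t)
  simp only [matrixAction_apply] at h
  have hcongr : causalConv (matrixAction d) k x t =
      causalConv (matrixAction d) k (fun s => f s + causalConv (matrixAction d) ρ f s) t := by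
    refine intervalIntegral.integral_congr fun s hs => ?_
    rw [uIcc_of_le ht] at hs
    simp only [hxf s hs.1]
  rw [h, hcongr, causalConv_kernel_solution matrixAction_mul hk hρ hρk ht (hfi t), hxf t ht, sub_neg_eq_add]

end Deterministic

/-! ### Square means and Brownian increments -/

section SquareMeans

variable {α E : Type*} [MeasurableSpace α] [NormedAddCommGroup E] {μ : Measure α}

theorem eLpNorm_two_sq (f : α → E) : eLpNorm f 2 μ ^ 2 = ∫⁻ x, ‖f x‖ₑ ^ 2 ∂μ := by
  have h := eLpNorm_nnreal_pow_eq_lintegral (μ := μ) (f := f) (p := 2) two_ne_zero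
  have h2 : ((2 : ℝ≥0) : ℝ) = (2 : ℕ) := by norm_num
  simp only [h2, ENNReal.rpow_natCast] at h
  exact_mod_cast h

theorem eLpNorm_two_le_ofReal_sqrt {f : α → E} {c : ℝ}
    (h : ∫⁻ x, ‖f x‖ₑ ^ 2 ∂μ ≤ ENNReal.ofReal c) : eLpNorm f 2 μ ≤ ENNReal.ofReal (√c) := by
  rw [← eLpNorm_two_sq] at h
  refine (ENNReal.pow_le_pow_left_iff two_ne_zero).1 (h.trans ?_)
  rcases le_total 0 c with hc | hc
  · rw [← ENNReal.ofReal_pow (Real.sqrt_nonneg c), Real.sq_sqrt hc]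
  · simp [ENNReal.ofReal_of_nonpos hc]

theorem sq_lintegral_enorm_le {f : α → E} (hf : AEStronglyMeasurable f μ) :
    (∫⁻ x, ‖f x‖ₑ ∂μ) ^ 2 ≤ μ univ * ∫⁻ x, ‖f x‖ₑ ^ 2 ∂μ := by
  have h := eLpNorm_le_eLpNorm_mul_rpow_measure_univ (p := 1) (q := 2) (by norm_num) hf
  rw [eLpNorm_one_eq_lintegral_enorm] at h
  calc (∫⁻ x, ‖f x‖ₑ ∂μ) ^ 2
      ≤ (eLpNorm f 2 μ * μ univ ^ (1 / (1 : ℝ≥0∞).toReal - 1 / (2 : ℝ≥0∞).toReal)) ^ 2 := by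
        gcongr
    _ = μ univ * ∫⁻ x, ‖f x‖ₑ ^ 2 ∂μ := by
        rw [mul_pow, eLpNorm_two_sq, mul_comm, ← ENNReal.rpow_natCast, ← ENNReal.rpow_mul]
        norm_num

theorem EuclideanSpace.enorm_sq_eq {d : ℕ} (x : EuclideanSpace ℝ (Fin d)) :
    ‖x‖ₑ ^ 2 = ∑ i, ‖x i‖ₑ ^ 2 := by
  simp only [← ofReal_norm, ← ENNReal.ofReal_pow (norm_nonneg _)]
  rw [EuclideanSpace.norm_sq_eq, ENNReal.ofReal_sum_of_nonneg fun _ _ => by positivity]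

end SquareMeans

section BrownianMotion

variable {Ω : Type*} [MeasurableSpace Ω] {P : Measure Ω} {d : ℕ}
  {W : ℝ≥0 → Ω → EuclideanSpace ℝ (Fin d)}

theorem lintegral_enorm_sq_gaussianReal (v : ℝ≥0) :
    ∫⁻ x, ‖x‖ₑ ^ 2 ∂gaussianReal 0 v = v := by
  have h := ofReal_variance (memLp_id_gaussianReal (μ := 0) (v := v) 2)
  rw [variance_id_gaussianReal, evariance] at h
  simpa using h.symm

theorem IsBrownianMotion.aemeasurable (hW : IsBrownianMotion W P) (t : ℝ≥0) :
    AEMeasurable (W t) P :=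
  (WithLp.measurable_toLp 2 _).comp_aemeasurable
    (aemeasurable_pi_lambda (fun ω i => W t ω i) fun i => (hW.coord i).aemeasurable t)

theorem IsBrownianMotion.ae_continuous (hW : IsBrownianMotion W P) :
    ∀ᵐ ω ∂P, Continuous fun t => W t ω := by
  filter_upwards [ae_all_iff.2 fun i => (hW.coord i).cont] with ω hω
  exact (PiLp.continuous_toLp 2 _).comp (continuous_pi hω)

theorem IsBrownianMotion.ae_eval_zero (hW : IsBrownianMotion W P) : ∀ᵐ ω ∂P, W 0 ω = 0 := by
  filter_upwards [ae_all_iff.2 fun i => (hW.coord i).eval_zero_ae_eq_zero] with ω hω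
  ext i
  exact hω i

theorem IsBrownianMotion.lintegral_enorm_sub_sq (hW : IsBrownianMotion W P) (s t : ℝ≥0) :
    ∫⁻ ω, ‖W s ω - W t ω‖ₑ ^ 2 ∂P = d * nndist s t := by
  have hi : ∀ i, ∫⁻ ω, ‖(W s ω - W t ω) i‖ₑ ^ 2 ∂P = nndist s t := fun i => by
    have h := ((hW.coord i).hasLaw_sub s t).lintegral_comp (f := fun x => ‖x‖ₑ ^ 2) (by fun_prop)
    rw [lintegral_enorm_sq_gaussianReal] at h
    exact h
  simp_rw [EuclideanSpace.enorm_sq_eq]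
  rw [lintegral_finsetSum' _ fun i _ => ?_]
  · simp_rw [hi]
    simp
  · exact (((hW.coord i).aemeasurable s).sub ((hW.coord i).aemeasurable t)).enorm.pow_const 2

theorem aemeasurable_prod_of_countable_index {β ι E : Type*} [MeasurableSpace β] {μ : Measure β}
    [MeasurableSpace ι] [Countable ι] [MeasurableSingletonClass ι]
    [MeasurableSpace E] {X : ι → Ω → E} (hX : ∀ k, AEMeasurable (X k) P) {idx : β → ι}
    (hidx : Measurable idx) :
    AEMeasurable (fun p : Ω × β => X (idx p.2) p.1) (P.prod μ) := by
  have hm : Measurable fun q : Ω × ι => (hX q.2).mk _ q.1 :=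
    measurable_from_prod_countable_left fun k => (hX k).measurable_mk
  refine ⟨fun p => (hX (idx p.2)).mk _ p.1,
    hm.comp (measurable_fst.prodMk (hidx.comp measurable_snd)), ?_⟩
  have h : ∀ᵐ ω ∂P, ∀ k, X k ω = (hX k).mk _ ω := ae_all_iff.2 fun k => (hX k).ae_eq_mk
  filter_upwards [Measure.quasiMeasurePreserving_fst.ae h] with p hp using hp _

/-- Paths are continuous only almost surely. Joint measurability comes from the discretized times
`⌊s n⌋ / n`: countably many values of `W` can be made measurable outside one null set. -/
theorem IsBrownianMotion.aestronglyMeasurable_prod (hW : IsBrownianMotion W P) (μ : Measure ℝ) :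
    AEStronglyMeasurable (fun p : Ω × ℝ => W p.2.toNNReal p.1) (P.prod μ) := by
  refine AEMeasurable.aestronglyMeasurable ?_
  refine aemeasurable_of_tendsto_metrizable_ae atTop
    (f := fun (n : ℕ) (p : Ω × ℝ) => W (⌊max p.2 0 * n⌋₊ / n) p.1) (fun n => ?_) ?_
  · have hidx : Measurable fun s : ℝ => ⌊max s 0 * n⌋₊ :=
      ((measurable_id.max measurable_const).mul_const _).nat_floor
    have hX : ∀ k : ℕ, AEMeasurable (W ((k : ℝ≥0) / n)) P := fun k => hW.aemeasurable _
    have h := aemeasurable_prod_of_countable_index (μ := μ) hX hidx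
    exact h
  · filter_upwards [Measure.quasiMeasurePreserving_fst.ae hW.ae_continuous] with p hp
    have h := (tendsto_nat_floor_mul_div_atTop (le_max_right p.2 0)).comp
      tendsto_natCast_atTop_atTop
    have h' : Tendsto (fun n : ℕ => (⌊max p.2 0 * n⌋₊ / n : ℝ≥0)) atTop (𝓝 p.2.toNNReal) := by
      rw [← NNReal.tendsto_coe]
      simpa [Function.comp_def] using h
    exact (hp.tendsto p.2.toNNReal).comp h'

end BrownianMotion

/-! ### Uniform step functions and summation by parts -/

section UniformSteps

variable {d : ℕ}

/-- The step function on `(0, T]` that takes the values of `f` at the right end points of a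
uniform partition into `n + 1` intervals. -/
noncomputable def MatrixStep.uniform (f : ℝ → Matrix (Fin d) (Fin d) ℝ) (T : ℝ≥0) (n : ℕ) :
    MatrixStep d T where
  n := n + 1
  left i := i * (T / (n + 1))
  right i := (i + 1) * (T / (n + 1))
  coeff i := f (((i + 1) * (T / (n + 1)) : ℝ≥0) : ℝ)
  left_le_right i := by
    gcongr
    exact le_self_add
  right_le i := by
    have h : ((i : ℕ) : ℝ≥0) + 1 ≤ n + 1 := by exact_mod_cast i.2
    calc ((i : ℕ) + 1 : ℝ≥0) * (T / (n + 1)) ≤ (n + 1) * (T / (n + 1)) := by gcongr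
      _ = T := mul_div_cancel₀ T (by positivity)

theorem MatrixStep.exists_uniform_toFun_eq (f : ℝ → Matrix (Fin d) (Fin d) ℝ) (T : ℝ≥0) (n : ℕ)
    {s : ℝ} (hs : s ∈ Ioc (0 : ℝ) T) :
    ∃ x ∈ Icc (0 : ℝ) T, |x - s| ≤ T / (n + 1) ∧ (MatrixStep.uniform f T n).toFun s = f x := by
  have hT : (0 : ℝ) < T := hs.1.trans_le hs.2
  have hN : (0 : ℝ) < n + 1 := by positivity
  set h : ℝ := T / (n + 1) with hh
  have hpos : 0 < h := by positivity
  have hNh : (n + 1) * h = T := mul_div_cancel₀ _ hN.ne'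
  -- The intervals are open on the left and closed on the right, so the one containing `s` has index
  -- `⌈s / h⌉ - 1`.
  obtain ⟨m, hm⟩ : ∃ m, ⌈s / h⌉₊ = m + 1 :=
    Nat.exists_eq_succ_of_ne_zero (Nat.ceil_pos.2 (div_pos hs.1 hpos)).ne'
  have h₁ : m * h < s := by
    have : (m : ℝ) < s / h := Nat.lt_ceil.1 (by omega)
    rwa [lt_div_iff₀ hpos] at this
  have h₂ : s ≤ (m + 1) * h := by
    have : s / h ≤ (m + 1 : ℕ) := hm ▸ Nat.le_ceil (s / h)
    rw [div_le_iff₀ hpos] at this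
    exact_mod_cast this
  have hmn : m < n + 1 := by
    have : (m : ℝ) * h < (n + 1) * h := by rw [hNh]; exact h₁.trans_le hs.2
    exact_mod_cast lt_of_mul_lt_mul_right this hpos.le
  have hmn' : (m : ℝ) + 1 ≤ n + 1 := by exact_mod_cast hmn
  refine ⟨(m + 1) * h, ⟨by positivity, ?_⟩, ?_, ?_⟩
  · rw [← hNh]
    gcongr
  · rw [abs_of_nonneg (by linarith)]
    linarith
  · rw [MatrixStep.toFun]
    refine (Finset.sum_eq_single (⟨m, hmn⟩ : Fin (n + 1)) ?_ ?_).trans ?_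
    · intro j _ hj
      refine indicator_of_notMem (fun hsj => hj ?_) _
      simp only [MatrixStep.uniform] at hsj
      push_cast at hsj
      have h₃ : ((j : ℕ) : ℝ) < m + 1 :=
        lt_of_mul_lt_mul_right (hsj.1.trans_le h₂) hpos.le
      have h₄ : (m : ℝ) < (j : ℕ) + 1 :=
        lt_of_mul_lt_mul_right (h₁.trans_le hsj.2) hpos.le
      have h₅ : (j : ℕ) < m + 1 := by exact_mod_cast h₃
      have h₆ : m < (j : ℕ) + 1 := by exact_mod_cast h₄
      exact Fin.ext (show (j : ℕ) = m by omega)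
    · exact fun h => absurd (Finset.mem_univ _) h
    · rw [indicator_of_mem]
      · simp [MatrixStep.uniform, hh]
      · simp only [MatrixStep.uniform]
        push_cast
        exact ⟨h₁, h₂⟩

theorem MatrixStep.tendsto_eLpNorm_uniform {f : ℝ → Matrix (Fin d) (Fin d) ℝ} (hf : Continuous f)
    (T : ℝ≥0) :
    Tendsto (fun n => eLpNorm (fun s => (MatrixStep.uniform f T n).toFun s - f s) 2
      (volume.restrict (Ioc (0 : ℝ) T))) atTop (𝓝 0) := by
  have huc := isCompact_Icc.uniformContinuousOn_of_continuous (s := Icc (0 : ℝ) T) hf.continuousOn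
  have hlim : Tendsto (fun ε : ℝ => volume.restrict (Ioc (0 : ℝ) T) univ ^ (2 : ℝ≥0∞).toReal⁻¹ *
      ENNReal.ofReal ε) (𝓝[>] 0) (𝓝 0) := by
    have h : Tendsto (fun ε : ℝ => ENNReal.ofReal ε) (𝓝[>] 0) (𝓝 0) := by
      simpa using (ENNReal.continuous_ofReal.tendsto 0).mono_left nhdsWithin_le_nhds
    simpa using ENNReal.Tendsto.const_mul (a := volume.restrict (Ioc (0 : ℝ) T) univ ^
      (2 : ℝ≥0∞).toReal⁻¹) h (Or.inr (by simp))
  refine tendsto_order.2 ⟨fun a ha => absurd ha (by simp), fun a ha => ?_⟩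
  obtain ⟨ε, hεa, hε⟩ := ((hlim.eventually_lt_const ha).and self_mem_nhdsWithin).exists
  obtain ⟨δ, hδ, hfδ⟩ := Metric.uniformContinuousOn_iff.1 huc ε hε
  have hn : ∀ᶠ n : ℕ in atTop, (T : ℝ) / (n + 1) < δ := by
    have := (tendsto_const_nhds (x := (T : ℝ))).div_atTop
      (tendsto_atTop_add_const_right atTop (1 : ℝ) tendsto_natCast_atTop_atTop)
    exact this.eventually_lt_const hδ
  filter_upwards [hn] with n hn
  refine (eLpNorm_le_of_ae_bound (C := ε) ?_).trans_lt hεa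
  refine (ae_restrict_iff' measurableSet_Ioc).2 (Eventually.of_forall fun s hs => ?_)
  obtain ⟨x, hx, hxs, hφ⟩ := MatrixStep.exists_uniform_toFun_eq f T n hs
  rw [hφ, ← dist_eq_norm]
  exact (hfδ x hx s (Ioc_subset_Icc_self hs) (by
    rw [Real.dist_eq]; exact hxs.trans_lt hn)).le

end UniformSteps

section SummationByParts

variable {E : Type*} [NormedAddCommGroup E] [NormedSpace ℝ E] [CompleteSpace E]

/-- Summation by parts for Riemann–Stieltjes sums of a continuously differentiable integrand. -/
theorem sum_apply_increment_eq {K κ : ℝ → E →L[ℝ] E} (hκ : Continuous κ)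
    (hK : ∀ a b, K a - K b = ∫ s in a..b, κ s) {w : ℝ → E} (hw : Continuous w) (s : ℕ → ℝ)
    (N : ℕ) :
    ∑ i ∈ Finset.range N, K (s (i + 1)) (w (s (i + 1)) - w (s i)) =
      K (s N) (w (s N)) - K (s 0) (w (s 0)) + (∫ x in s 0..s N, κ x (w x)) -
        ∑ i ∈ Finset.range N, ∫ x in s i..s (i + 1), κ x (w x - w (s i)) := by
  induction N with
  | zero => simp
  | succ N ih =>
    have hi : ∀ a b, IntervalIntegrable (fun x => κ x (w x)) volume a b := fun a b =>
      (hκ.clm_apply hw).intervalIntegrable a b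
    have hi' : ∀ (y : E) a b, IntervalIntegrable (fun x => κ x y) volume a b := fun y a b =>
      (hκ.clm_apply continuous_const).intervalIntegrable a b
    have h₁ : ∫ x in s N..s (N + 1), κ x (w (s N)) = K (s N) (w (s N)) -
        K (s (N + 1)) (w (s N)) := by
      rw [← sub_apply, hK]
      exact (ContinuousLinearMap.apply ℝ E (w (s N))).intervalIntegral_comp_comm
        (hκ.intervalIntegrable _ _)
    have h₂ : ∫ x in s N..s (N + 1), κ x (w x - w (s N)) =
        (∫ x in s N..s (N + 1), κ x (w x)) - (K (s N) (w (s N)) - K (s (N + 1)) (w (s N))) := by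
      rw [← h₁, ← intervalIntegral.integral_sub (hi _ _) (hi' _ _ _)]
      simp only [map_sub]
    rw [Finset.sum_range_succ, ih, Finset.sum_range_succ, h₂, map_sub,
      ← intervalIntegral.integral_add_adjacent_intervals (hi (s 0) (s N)) (hi (s N) (s (N + 1)))]
    abel

end SummationByParts

/-! ### Error estimate and the Wiener integral -/

section IncrementEstimate

variable {Ω : Type*} [MeasurableSpace Ω] {P : Measure Ω} {d : ℕ}
  {W : ℝ≥0 → Ω → EuclideanSpace ℝ (Fin d)}
  {κ : ℝ → EuclideanSpace ℝ (Fin d) →L[ℝ] EuclideanSpace ℝ (Fin d)}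

theorem IsBrownianMotion.aestronglyMeasurable_clm_apply_sub (hW : IsBrownianMotion W P)
    (hκ : Continuous κ) (u : ℝ) (μ : Measure ℝ) [SFinite μ] :
    AEStronglyMeasurable (fun p : Ω × ℝ => κ p.2 (W p.2.toNNReal p.1 - W u.toNNReal p.1))
      (P.prod μ) := by
  have h₁ : AEStronglyMeasurable (fun p : Ω × ℝ => κ p.2) (P.prod μ) :=
    (hκ.stronglyMeasurable.comp_measurable measurable_snd).aestronglyMeasurable
  have h₂ : AEStronglyMeasurable (fun p : Ω × ℝ => W u.toNNReal p.1) (P.prod μ) :=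
    (hW.aemeasurable u.toNNReal).aestronglyMeasurable.comp_quasiMeasurePreserving
      Measure.quasiMeasurePreserving_fst
  exact (ContinuousLinearMap.id ℝ _).aestronglyMeasurable_comp₂ h₁
    ((hW.aestronglyMeasurable_prod μ).sub h₂)

theorem IsBrownianMotion.aestronglyMeasurable_integral_increment (hW : IsBrownianMotion W P)
    (hκ : Continuous κ) (u v : ℝ) (huv : u ≤ v) :
    AEStronglyMeasurable
      (fun ω => ∫ s in u..v, κ s (W s.toNNReal ω - W u.toNNReal ω)) P := by
  simp only [intervalIntegral.integral_of_le huv]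
  exact (hW.aestronglyMeasurable_clm_apply_sub hκ u _).integral_prod_right'

variable [IsProbabilityMeasure P]

/-- One factor `v - u` comes from Cauchy–Schwarz in time, one from the variance `d |s - u|` of the
increment, one from integrating over `s`. -/
theorem IsBrownianMotion.eLpNorm_integral_increment_le (hW : IsBrownianMotion W P)
    (hκ : Continuous κ) {u v C : ℝ} (huv : u ≤ v) (hC : 0 ≤ C)
    (hκC : ∀ s ∈ Icc u v, ‖κ s‖ ≤ C) :
    eLpNorm (fun ω => ∫ s in u..v, κ s (W s.toNNReal ω - W u.toNNReal ω)) 2 P ≤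
      ENNReal.ofReal (√(C ^ 2 * d * (v - u) ^ 3)) := by
  have huv' : 0 ≤ v - u := sub_nonneg.2 huv
  refine eLpNorm_two_le_ofReal_sqrt ?_
  set μ := volume.restrict (Ioc u v) with hμ
  set g : Ω → ℝ → EuclideanSpace ℝ (Fin d) :=
    fun ω s => κ s (W s.toNNReal ω - W u.toNNReal ω) with hg
  have hgm : AEStronglyMeasurable (fun p : Ω × ℝ => g p.1 p.2) (P.prod μ) :=
    hW.aestronglyMeasurable_clm_apply_sub hκ u μ
  have hμu : μ univ = ENNReal.ofReal (v - u) := by simp [hμ]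
  have hinner : ∀ s ∈ Ioc u v, ∫⁻ ω, ‖g ω s‖ₑ ^ 2 ∂P ≤ ENNReal.ofReal (C ^ 2 * d * (v - u)) := by
    intro s hs
    have hnn : nndist s.toNNReal u.toNNReal ≤ (v - u).toNNReal := by
      rw [← NNReal.coe_le_coe, Real.coe_toNNReal _ huv', coe_nndist, NNReal.dist_eq,
        Real.coe_toNNReal', Real.coe_toNNReal']
      refine (abs_max_sub_max_le_abs s u 0).trans ?_
      rw [abs_of_nonneg (by linarith [hs.1])]
      linarith [hs.2]
    calc ∫⁻ ω, ‖g ω s‖ₑ ^ 2 ∂P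
        ≤ ∫⁻ ω, ENNReal.ofReal C ^ 2 * ‖W s.toNNReal ω - W u.toNNReal ω‖ₑ ^ 2 ∂P := by
          refine lintegral_mono fun ω => ?_
          rw [← mul_pow]
          gcongr
          refine ((κ s).le_opENorm _).trans ?_
          gcongr
          rw [← ofReal_norm]
          exact ENNReal.ofReal_le_ofReal (hκC s (Ioc_subset_Icc_self hs))
      _ = ENNReal.ofReal C ^ 2 * (d * nndist s.toNNReal u.toNNReal) := by
          rw [lintegral_const_mul' _ _ (by simp), hW.lintegral_enorm_sub_sq]
      _ ≤ ENNReal.ofReal C ^ 2 * (d * (v - u).toNNReal) := by gcongr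
      _ = ENNReal.ofReal (C ^ 2 * d * (v - u)) := by
          rw [ENNReal.ofReal_mul (by positivity), ENNReal.ofReal_mul (by positivity),
            ENNReal.ofReal_pow hC, ENNReal.ofReal_natCast, mul_assoc]
          rfl
  calc ∫⁻ ω, ‖∫ s in u..v, g ω s‖ₑ ^ 2 ∂P
      ≤ ∫⁻ ω, μ univ * ∫⁻ s, ‖g ω s‖ₑ ^ 2 ∂μ ∂P := by
        refine lintegral_mono_ae ?_
        filter_upwards [hgm.prodMk_left] with ω hω
        refine le_trans ?_ (sq_lintegral_enorm_le hω)
        gcongr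
        rw [intervalIntegral.integral_of_le huv]
        exact enorm_integral_le_lintegral_enorm _
    _ = μ univ * ∫⁻ s, ∫⁻ ω, ‖g ω s‖ₑ ^ 2 ∂P ∂μ := by
        rw [lintegral_const_mul' _ _ (by simp [hμu]), lintegral_lintegral_swap]
        exact hgm.enorm.pow_const 2
    _ ≤ μ univ * ∫⁻ _, ENNReal.ofReal (C ^ 2 * d * (v - u)) ∂μ := by
        gcongr μ univ * ?_
        exact lintegral_mono_ae ((ae_restrict_iff' measurableSet_Ioc).2
          (Eventually.of_forall hinner))
    _ = ENNReal.ofReal (C ^ 2 * d * (v - u) ^ 3) := by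
        rw [lintegral_const, hμu, ← ENNReal.ofReal_mul (by positivity),
          ← ENNReal.ofReal_mul huv']
        congr 1
        ring

end IncrementEstimate

/-- The sign convention is `φ = -f'`, and `W 0 = 0` removes the lower boundary term. -/
theorem MatrixStep.integral_uniform_sub {Ω : Type*} {d : ℕ}
    {W : ℝ≥0 → Ω → EuclideanSpace ℝ (Fin d)} {f φ : ℝ → Matrix (Fin d) (Fin d) ℝ}
    (hφ : Continuous φ) (hfφ : ∀ a b, f a - f b = ∫ s in a..b, φ s) (T : ℝ≥0) (n : ℕ)
    {ω : Ω} (hc : Continuous fun t => W t ω) (h₀ : W 0 ω = 0) :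
    (MatrixStep.uniform f T n).integral W ω -
        ((f T ∙ᵥ W T ω) + ∫ s in (0 : ℝ)..T, φ s ∙ᵥ W s.toNNReal ω) =
      -∑ i ∈ Finset.range (n + 1), ∫ x in (i * (T / (n + 1)) : ℝ)..((i + 1 : ℕ) * (T / (n + 1)) : ℝ),
        matrixAction d (φ x) (W x.toNNReal ω - W (i * (T / (n + 1)) : ℝ).toNNReal ω) := by
  have hsum := sum_apply_increment_eq (K := fun s => matrixAction d (f s))
    (κ := fun s => matrixAction d (φ s)) (by fun_prop)
    (fun a b => by
      rw [← map_sub, hfφ]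
      exact ((matrixAction d).intervalIntegral_comp_comm (hφ.intervalIntegrable _ _)).symm)
    (w := fun s => W s.toNNReal ω) (hc.comp continuous_real_toNNReal)
    (fun i => i * (T / (n + 1))) (n + 1)
  have hT : ((n + 1 : ℕ) : ℝ) * (T / (n + 1)) = T := by
    push_cast
    exact mul_div_cancel₀ _ (by positivity)
  have hstep : (MatrixStep.uniform f T n).integral W ω = ∑ i ∈ Finset.range (n + 1),
      matrixAction d (f ((i + 1 : ℕ) * (T / (n + 1))))
        (W ((i + 1 : ℕ) * (T / (n + 1)) : ℝ).toNNReal ω - W (i * (T / (n + 1)) : ℝ).toNNReal ω) := by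
    rw [← Fin.sum_univ_eq_sum_range (fun i => matrixAction d (f ((i + 1 : ℕ) * (T / (n + 1))))
        (W ((i + 1 : ℕ) * (T / (n + 1)) : ℝ).toNNReal ω -
          W (i * (T / (n + 1)) : ℝ).toNNReal ω))]
    refine Finset.sum_congr rfl fun i _ => ?_
    have h₁ : (((i : ℕ) + 1 : ℕ) * (T / (n + 1)) : ℝ) =
        ((((i : ℕ) + 1) * (T / (n + 1)) : ℝ≥0) : ℝ) := by push_cast; rfl
    have h₂ : ((i : ℕ) * (T / (n + 1)) : ℝ) = (((i : ℕ) * (T / (n + 1)) : ℝ≥0) : ℝ) := by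
      push_cast; rfl
    rw [h₁, h₂, Real.toNNReal_coe, Real.toNNReal_coe]
    rfl
  rw [hstep, hsum, hT]
  simp only [Nat.cast_zero, zero_mul, Real.toNNReal_zero, h₀, map_zero, Real.toNNReal_coe,
    matrixAction_apply]
  abel

section WienerIntegral

variable {Ω : Type*} [MeasurableSpace Ω] {P : Measure Ω} {d : ℕ}
  {W : ℝ≥0 → Ω → EuclideanSpace ℝ (Fin d)}

theorem IsBrownianMotion.memLp_sub (hW : IsBrownianMotion W P) (s t : ℝ≥0) :
    MemLp (fun ω => W s ω - W t ω) 2 P := by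
  refine ⟨((hW.aemeasurable s).sub (hW.aemeasurable t)).aestronglyMeasurable, ?_⟩
  refine (ENNReal.pow_lt_top_iff (n := 2).1 ?_).resolve_right two_ne_zero
  rw [eLpNorm_two_sq, hW.lintegral_enorm_sub_sq]
  exact ENNReal.mul_lt_top (by simp) ENNReal.coe_lt_top

theorem IsBrownianMotion.memLp_integral (hW : IsBrownianMotion W P) {T : ℝ≥0}
    (φ : MatrixStep d T) : MemLp (φ.integral W) 2 P :=
  memLp_finsetSum _ fun i _ =>
    (Matrix.toEuclideanCLM (𝕜 := ℝ) (φ.coeff i)).comp_memLp' (hW.memLp_sub _ _)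

variable [IsProbabilityMeasure P]

/-- The Wiener integral of a continuously differentiable integrand is given by integration by
parts. -/
theorem IsBrownianMotion.isWienerIntegral_of_primitive (hW : IsBrownianMotion W P)
    {f φ : ℝ → Matrix (Fin d) (Fin d) ℝ} (hf : Continuous f)
    (hφ : Continuous φ) (hfφ : ∀ a b, f a - f b = ∫ s in a..b, φ s) (T : ℝ≥0) :
    IsWienerIntegral P W f T
      (fun ω => (f T ∙ᵥ W T ω) + ∫ s in (0 : ℝ)..T, φ s ∙ᵥ W s.toNNReal ω) := by
  have hκ : Continuous fun s => matrixAction d (φ s) := by fun_prop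
  set err : ℕ → ℕ → Ω → EuclideanSpace ℝ (Fin d) := fun n i ω =>
    ∫ x in (i * (T / (n + 1)) : ℝ)..((i + 1 : ℕ) * (T / (n + 1)) : ℝ),
      matrixAction d (φ x) (W x.toNNReal ω - W (i * (T / (n + 1)) : ℝ).toNNReal ω) with herr
  set Y : Ω → EuclideanSpace ℝ (Fin d) :=
    fun ω => (f T ∙ᵥ W T ω) + ∫ s in (0 : ℝ)..T, φ s ∙ᵥ W s.toNNReal ω with hY
  have hkey : ∀ n, (fun ω => (MatrixStep.uniform f T n).integral W ω - Y ω) =ᵐ[P]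
      -∑ i ∈ Finset.range (n + 1), err n i := fun n => by
    filter_upwards [hW.ae_continuous, hW.ae_eval_zero] with ω hc h₀
    rw [MatrixStep.integral_uniform_sub hφ hfφ T n hc h₀]
    simp [herr]
  have hle : ∀ n i : ℕ, (i * (T / (n + 1)) : ℝ) ≤ ((i + 1 : ℕ) * (T / (n + 1)) : ℝ) :=
    fun n i => by gcongr; simp
  have hmeas : ∀ n i, AEStronglyMeasurable (err n i) P := fun n i =>
    hW.aestronglyMeasurable_integral_increment hκ _ _ (hle n i)
  obtain ⟨C, hC₀, hC⟩ := hκ.exists_norm_le_Icc T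
  have herr_le : ∀ n i : ℕ, i < n + 1 →
      eLpNorm (err n i) 2 P ≤ ENNReal.ofReal (√(C ^ 2 * d * (T / (n + 1)) ^ 3)) := by
    intro n i hi
    have hi' : ((i + 1 : ℕ) : ℝ) ≤ n + 1 := by exact_mod_cast hi
    have h := hW.eLpNorm_integral_increment_le hκ (hle n i) hC₀ fun s hs => hC s
      ⟨le_trans (by positivity) hs.1, hs.2.trans (by
        calc ((i + 1 : ℕ) : ℝ) * (T / (n + 1)) ≤ (n + 1) * (T / (n + 1)) := by gcongr
          _ = T := mul_div_cancel₀ _ (by positivity))⟩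
    have hsub : ((i + 1 : ℕ) : ℝ) * (T / (n + 1)) - i * (T / (n + 1)) = T / (n + 1) := by
      push_cast; ring
    rwa [hsub] at h
  -- The triangle inequality suffices: `n + 1` errors of order `(T / (n + 1))^(3/2)` add up to order
  -- `(n + 1)^(-1/2)`.
  have hbound : ∀ n : ℕ, eLpNorm (fun ω => (MatrixStep.uniform f T n).integral W ω - Y ω) 2 P ≤
      ENNReal.ofReal (√(C ^ 2 * d * T ^ 3 / (n + 1))) := by
    intro n
    rw [eLpNorm_congr_ae (hkey n), eLpNorm_neg]
    refine (eLpNorm_sum_le (fun i _ => hmeas n i) (by norm_num)).trans ?_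
    refine (Finset.sum_le_sum fun i hi => herr_le n i (Finset.mem_range.1 hi)).trans_eq ?_
    have hn : (0 : ℝ) < n + 1 := by positivity
    rw [Finset.sum_const, Finset.card_range, nsmul_eq_mul, ← ENNReal.ofReal_natCast,
      ← ENNReal.ofReal_mul (by positivity)]
    have hsqrt : ∀ x : ℝ, ((n : ℝ) + 1) * √x = √((n + 1) ^ 2 * x) := fun x => by
      rw [Real.sqrt_mul (by positivity), Real.sqrt_sq hn.le]
    push_cast
    rw [hsqrt]
    congr 2
    field_simp
  refine ⟨?_, ?_, MatrixStep.uniform f T, MatrixStep.tendsto_eLpNorm_uniform hf T, ?_⟩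
  · obtain ⟨M, -, hM⟩ := hf.exists_norm_le_Icc T
    exact MemLp.of_bound hf.aestronglyMeasurable M ((ae_restrict_iff' measurableSet_Ioc).2
      (Eventually.of_forall fun s hs => hM s (Ioc_subset_Icc_self hs)))
  -- Square integrability of `Y` follows from the one-interval partition: both the step integral and
  -- its error are in `L²`.
  · have h₁ : MemLp (fun ω => (MatrixStep.uniform f T 0).integral W ω - Y ω) 2 P :=
      ⟨(Finset.aestronglyMeasurable_sum _ fun i _ => hmeas 0 i).neg.congr (hkey 0).symm,
        (hbound 0).trans_lt ENNReal.ofReal_lt_top⟩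
    exact ((hW.memLp_integral (MatrixStep.uniform f T 0)).sub h₁).ae_eq
      (Eventually.of_forall fun ω => by simp)
  · refine tendsto_of_tendsto_of_tendsto_of_le_of_le tendsto_const_nhds ?_ (fun _ => zero_le)
      hbound
    have h : Tendsto (fun n : ℕ => C ^ 2 * d * T ^ 3 / ((n : ℝ) + 1)) atTop (𝓝 0) :=
      tendsto_const_nhds.div_atTop
        (tendsto_atTop_add_const_right atTop (1 : ℝ) tendsto_natCast_atTop_atTop)
    simpa [Function.comp_def] using (ENNReal.continuous_ofReal.comp Real.continuous_sqrt).tendsto 0 |>.comp h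

end WienerIntegral

/-! ### Paths of the random force -/

section RandomForce

variable {Ω : Type*} [MeasurableSpace Ω] {P : Measure Ω} [IsProbabilityMeasure P] {d : ℕ}
  {F : ℝ → Ω → EuclideanSpace ℝ (Fin d)}

theorem aestronglyMeasurable_prod_restrict
    (hF : AEMeasurable (Function.uncurry F) ((volume.restrict (Ici (0 : ℝ))).prod P))
    {s : Set ℝ} (hs : s ⊆ Ici 0) :
    AEStronglyMeasurable (fun p : Ω × ℝ => F p.2 p.1) (P.prod (volume.restrict s)) :=
  hF.aestronglyMeasurable.prod_swap.mono_ac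
    (Measure.AbsolutelyContinuous.rfl.prod (Measure.restrict_mono hs le_rfl).absolutelyContinuous)

/-- By Tonelli the expectation of `∫₀ⁿ ‖F‖` is at most `n C`; integer horizons `n` leave a countable
union of null sets. -/
theorem ae_integrableOn_paths
    (hF : AEMeasurable (Function.uncurry F) ((volume.restrict (Ici (0 : ℝ))).prod P))
    (hFt : ∀ t, 0 ≤ t → AEStronglyMeasurable (F t) P)
    (hbdd : ∃ C : ℝ≥0, ∀ t : ℝ, 0 ≤ t → eLpNorm (F t) 2 P ≤ C) :
    ∀ᵐ ω ∂P, ∀ T : ℝ, IntegrableOn (fun s => F s ω) (Icc 0 T) := by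
  obtain ⟨C, hC⟩ := hbdd
  have hn : ∀ n : ℕ, ∀ᵐ ω ∂P, IntegrableOn (fun s => F s ω) (Icc 0 (n : ℝ)) := fun n => by
    have hm := aestronglyMeasurable_prod_restrict hF
      (Icc_subset_Ici_self : Icc 0 (n : ℝ) ⊆ Ici 0)
    refine Integrable.prod_right_ae (f := fun p : Ω × ℝ => F p.2 p.1) ⟨hm, ?_⟩
    rw [HasFiniteIntegral, lintegral_prod_symm _ hm.enorm]
    calc ∫⁻ s in Icc 0 (n : ℝ), ∫⁻ ω, ‖F s ω‖ₑ ∂P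
        ≤ ∫⁻ _ in Icc 0 (n : ℝ), C := by
          refine setLIntegral_mono' measurableSet_Icc fun s hs => ?_
          rw [← eLpNorm_one_eq_lintegral_enorm]
          exact (eLpNorm_le_eLpNorm_of_exponent_le (by norm_num) (hFt s hs.1)).trans (hC s hs.1)
      _ < ∞ := by simp [ENNReal.mul_lt_top]
  filter_upwards [ae_all_iff.2 hn] with ω hω T
  obtain ⟨n, hn⟩ := exists_nat_ge T
  exact (hω n).mono_set (Icc_subset_Icc_right hn)

theorem aemeasurable_integral_clm_apply
    (hF : AEMeasurable (Function.uncurry F) ((volume.restrict (Ici (0 : ℝ))).prod P))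
    {κ : ℝ → EuclideanSpace ℝ (Fin d) →L[ℝ] EuclideanSpace ℝ (Fin d)} (hκ : Continuous κ)
    {t : ℝ} (ht : 0 ≤ t) : AEMeasurable (fun ω => ∫ s in (0 : ℝ)..t, κ s (F s ω)) P := by
  simp only [intervalIntegral.integral_of_le ht]
  have h₁ : AEStronglyMeasurable (fun p : Ω × ℝ => κ p.2)
      (P.prod (volume.restrict (Ioc 0 t))) :=
    (hκ.stronglyMeasurable.comp_measurable measurable_snd).aestronglyMeasurable
  exact ((ContinuousLinearMap.id ℝ _).aestronglyMeasurable_comp₂ h₁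
    (aestronglyMeasurable_prod_restrict hF
      (Ioc_subset_Icc_self.trans Icc_subset_Ici_self))).integral_prod_right'.aemeasurable

end RandomForce

theorem theorem1 {Ω : Type*} [MeasurableSpace Ω] (P : Measure Ω) [IsProbabilityMeasure P] {d : ℕ}
    (D G : Matrix (Fin d) (Fin d) ℝ) (γ : ℝ → Matrix (Fin d) (Fin d) ℝ)
    (hγ : LocallyIntegrableOn γ (Ici 0))
    (V₀ : Ω → EuclideanSpace ℝ (Fin d)) (hV₀ : HasGaussianLaw V₀ P) (hV₀_mean : ∫ ω, V₀ ω ∂P = 0)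
    (F₀ : ℝ → Ω → EuclideanSpace ℝ (Fin d))
    (hF₀_gauss : IsGaussianProcess (fun t : ℝ≥0 => F₀ t) P)
    (hF₀_meas : AEMeasurable (Function.uncurry F₀) ((volume.restrict (Ici (0 : ℝ))).prod P))
    (hF₀_ms : IsMeanSquareBoundedContinuous F₀ P)
    (W : ℝ≥0 → Ω → EuclideanSpace ℝ (Fin d)) (hW : IsBrownianMotion W P) :
    ∃ r : ℝ → Matrix (Fin d) (Fin d) ℝ,
      -- `r` is the differential resolvent
      IsDifferentialResolvent D γ r ∧
      (∀ r' : ℝ → Matrix (Fin d) (Fin d) ℝ, IsDifferentialResolvent D γ r' →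
        ∀ t : ℝ, 0 ≤ t → r' t = r t) ∧
      ∃ V : ℝ → Ω → EuclideanSpace ℝ (Fin d),
        -- existence of a strong solution
        IsStrongSolution P D γ V₀ F₀ G W V ∧
        -- uniqueness up to indistinguishability
        (∀ V' : ℝ → Ω → EuclideanSpace ℝ (Fin d), IsStrongSolution P D γ V₀ F₀ G W V' →
          ∀ᵐ ω ∂P, ∀ t : ℝ, 0 ≤ t → V' t ω = V t ω) ∧
        -- variation of constants: `V(t) = r(t) V₀ + ∫₀ᵗ r(t-s) F₀(s) ds + ∫₀ᵗ r(t-s) G dW(s)`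
        ∀ t : ℝ≥0, ∃ Y : Ω → EuclideanSpace ℝ (Fin d),
          IsWienerIntegral P W (fun s => r (t - s) * G) t Y ∧
          ∀ᵐ ω ∂P, V t ω = r t ∙ᵥ V₀ ω + (∫ s in (0 : ℝ)..t, r (t - s) ∙ᵥ F₀ s ω) + Y ω := by
  have hγ' := locallyIntegrableOn_Ici_iff.1 hγ
  obtain ⟨k, hk, hkγ⟩ := exists_continuous_memory_primitive D hγ'
  -- The inhomogeneity `-k` makes `ρ` the resolvent kernel of `k`.
  obtain ⟨ρ, hρ, hρk⟩ := exists_volterra_solution (ContinuousLinearMap.mul ℝ _) hk hk.neg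
  set r : ℝ → Matrix (Fin d) (Fin d) ℝ := fun t => 1 + ∫ s in (0 : ℝ)..t, ρ s with hr
  have hres : IsDifferentialResolvent D γ r :=
    isDifferentialResolvent_of_kernel hk hρ hkγ hγ' hρk
  have hrc : Continuous r := continuous_const.add
    (intervalIntegral.continuous_primitive (fun _ _ => hρ.intervalIntegrable _ _) 0)
  have hF₀t : ∀ t, 0 ≤ t → AEStronglyMeasurable (F₀ t) P := fun t ht =>
    (hF₀_gauss.hasGaussianLaw_eval ⟨t, ht⟩).aemeasurable.aestronglyMeasurable
  have hF₀i := ae_integrableOn_paths hF₀_meas hF₀t hF₀_ms.bounded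
  -- The Wiener integral is defined only up to a null set for each `t`. The integrated-by-parts
  -- version is defined for all `t` and `ω` at once, as the pathwise equation requires.
  let Y : ℝ≥0 → Ω → EuclideanSpace ℝ (Fin d) := fun t ω =>
    ((r (t - t) * G) ∙ᵥ W t ω) + ∫ s in (0 : ℝ)..t, (ρ (t - s) * G) ∙ᵥ W s.toNNReal ω
  have hY : ∀ t : ℝ≥0, IsWienerIntegral P W (fun s => r (t - s) * G) t (Y t) := fun t => by
    refine hW.isWienerIntegral_of_primitive (f := fun s => r (t - s) * G)
      (φ := fun s => ρ (t - s) * G) (by fun_prop) (by fun_prop) (fun a b => ?_) t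
    have h₁ : ∫ s in a..b, ρ (t - s) * G = (∫ s in a..b, ρ (t - s)) * G :=
      ((ContinuousLinearMap.mul ℝ (Matrix (Fin d) (Fin d) ℝ)).flip G).intervalIntegral_comp_comm
        ((hρ.comp (continuous_const.sub continuous_id)).intervalIntegrable _ _)
    rw [h₁, intervalIntegral.integral_comp_sub_left, ← sub_mul, hr, add_sub_add_left_eq_sub,
      intervalIntegral.integral_interval_sub_left (hρ.intervalIntegrable _ _)
        (hρ.intervalIntegrable _ _)]
  let V : ℝ → Ω → EuclideanSpace ℝ (Fin d) := fun t ω =>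
    (r t ∙ᵥ V₀ ω) + (∫ s in (0 : ℝ)..t, r (t - s) ∙ᵥ F₀ s ω) + Y t.toNNReal ω
  have hpath : ∀ᵐ ω ∂P, (∀ T, IntegrableOn (fun s => V s ω) (Icc 0 T)) ∧ ∀ t, 0 ≤ t →
      V t ω = (V₀ ω + (∫ s in (0 : ℝ)..t, F₀ s ω) + G ∙ᵥ W t.toNNReal ω) -
        ((D ∙ᵥ ∫ s in (0 : ℝ)..t, V s ω) +
          ∫ τ in (0 : ℝ)..t, ∫ s in (0 : ℝ)..τ, γ (τ - s) ∙ᵥ V s ω) := by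
    filter_upwards [hF₀i, hW.ae_continuous] with ω hFω hWω
    refine langevin_path_solution hk hρ hkγ hγ' hρk (F := fun s => F₀ s ω)
      (w := fun s => G ∙ᵥ W s.toNNReal ω) hFω
      ((Matrix.toEuclideanCLM (𝕜 := ℝ) G).continuous.comp (hWω.comp continuous_real_toNNReal))
      fun t ht => ?_
    simp only [V, Y, hr, Real.coe_toNNReal t ht, sub_self, intervalIntegral.integral_same, add_zero,
      one_mul, map_mul]
    rfl
  have hV : IsStrongSolution P D γ V₀ F₀ G W V := by
    refine ⟨fun t ht => ?_, ?_, ?_, ?_⟩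
    · refine AEMeasurable.add (AEMeasurable.add ?_ ?_) ?_
      · exact (Matrix.toEuclideanCLM (𝕜 := ℝ) (r t)).measurable.comp_aemeasurable hV₀.aemeasurable
      · exact aemeasurable_integral_clm_apply hF₀_meas
          (κ := fun s => matrixAction d (r (t - s))) (by fun_prop) ht
      · exact (hY _).memLp_integral.aestronglyMeasurable.aemeasurable
    · filter_upwards [hF₀i] with ω hω using locallyIntegrableOn_Ici_iff.2 hω
    · filter_upwards [hpath] with ω hω using locallyIntegrableOn_Ici_iff.2 hω.1
    · filter_upwards [hpath] with ω hω t
      rw [hω.2 t t.2, Real.toNNReal_coe]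
      abel
  refine ⟨r, hres, fun r' hr' t ht => hres.unique hr' hγ' ht, V, hV, fun V' hV' => ?_,
    fun t => ⟨Y t, hY t, Eventually.of_forall fun ω => by simp only [V, Real.toNNReal_coe]⟩⟩
  filter_upwards [hV'.locallyIntegrable, hV'.equation, hpath] with ω hi he hω t ht
  refine langevin_path_unique hγ' (locallyIntegrableOn_Ici_iff.1 hi) hω.1 (D := D)
    (f := fun t => V₀ ω + (∫ s in (0 : ℝ)..t, F₀ s ω) + G ∙ᵥ W t.toNNReal ω)
    (fun s hs => ?_) hω.2 ht
  have h := he s.toNNReal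
  rw [Real.coe_toNNReal s hs] at h
  rw [h]
  abel
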